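/- Let $m,n\ge 1$ be integers and let $\mathcal L=\{P,L,I\}$, with unary predicates $P$ ("points") and $L$ ("lines") and a binary relation symbol $I$ ("incidence"). An incidence structure is an $\mathcal L$-structure in which $P$ and $L$ partition the domain and $I(x,y)$ holds only if $x$ is a point and $y$ is a line. It is $K_{m,n}$-free if there are no $m$ distinct points and $n$ distinct lines such that each of these points is incident to each of these lines. Let $T^p_{m,n}$ be the theory of $K_{m,n}$-free incidence structures, and let $T^c_{m,n}$ be the theory of $K_{m,n}$-free incidence structures in which any $m$ distinct points lie on exactly $n-1$ common lines and any $n$ distinct lines have exactly $m-1$ common points. A safe diagram $\Delta(\overline x;\overline y)$ is the conjunction of all atomic and negated atomic formulas true in some finite $A\models T^p_{m,n}$ whose elements are labelled bijectively by the variables in the finite tuple $\overline x\,\overline y$, such that each point in $\overline y$ is incident in $A$ to at most $n-1$ lines in $\overline x$, and each line in $\overline y$ is incident in $A$ to at most $m-1$ points in $\overline x$. Let $\widehat\Delta(\overline x)$ be the conjunction of those atomic and negated atomic formulas in $\Delta$ that mention only variables in $\overline x$. Let $$T_{m,n}=T^c_{m,n}\cup\{\forall\overline x\,(\widehat\Delta(\overline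 x)\to\exists\overline y\,\Delta(\overline x;\overline y)) : \Delta \text{ a safe diagram}\}.$$ **Theorem.** For all $m,n\ge 1$, the theory $T_{m,n}$ has weak elimination of imaginaries: for every model $M\models T_{m,n}$ and every imaginary $e\in M^{\mathrm{eq}}$ there is a finite tuple $a$ of (real) elements of $M$ such that $e\in\operatorname{dcl}^{\mathrm{eq}}(a)$ and $a\in\operatorname{acl}^{\mathrm{eq}}(e)$. Here $M^{\mathrm{eq}}$ is the expansion of $M$ by a sort $M^k/E$, with its quotient map from $M^k$, for each $k$ and each equivalence relation $E$ on $M^k$ that is definable without parameters. An element is in $\operatorname{dcl}^{\mathrm{eq}}(A)$ (respectively $\operatorname{acl}^{\mathrm{eq}}(A)$) if it is the only element of a subset (respectively lies in a finite subset) of $M^{\mathrm{eq}}$ definable with parameters in $A$. -/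

import Mathlib

open FirstOrder FirstOrder.Language

universe u v w

/-! ## Imaginaries: the structure `M^eq`, definable and algebraic closure -/

namespace Imaginaries

/-- An imaginary sort of an `L`-structure `M`: an `L`-formula without parameters, in two `k`-tuples
of variables, which defines an equivalence relation on `M^k`.  (Which formulas qualify depends only
on the complete theory of `M`.) -/
structure ImagSort (L : FirstOrder.Language.{u, v}) (M : Type w) [L.Structure M] where
  /-- the length `k` of the tuples -/
  arity : ℕ
  /-- the formula `E(x, y)` -/
  fml : L.Formula (Fin arity ⊕ Fin arity)
  /-- `E` defines an equivalence relation on `M^k` -/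
  equiv : Equivalence fun a b : Fin arity → M => fml.Realize (Sum.elim a b)

/-- The equivalence relation on `M^k` that belongs to an imaginary sort. -/
def ImagSort.setoid {L : FirstOrder.Language.{u, v}} {M : Type w} [L.Structure M] (S : ImagSort L M) :
    Setoid (Fin S.arity → M) :=
  ⟨fun a b => S.fml.Realize (Sum.elim a b), S.equiv⟩

/-- The domain of `M^eq`: the disjoint union of the home sort `M` and of the sorts `M^k / E`, one for
each parameter-free definable equivalence relation `E`. -/
def Meq (L : FirstOrder.Language.{u, v}) (M : Type w) [L.Structure M] : Type (max u v w) :=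
  M ⊕ (Σ S : ImagSort L M, Quotient S.setoid)

/-- The inclusion of the home sort: real elements as elements of `M^eq`. -/
def Meq.real (L : FirstOrder.Language.{u, v}) {M : Type w} [L.Structure M] (a : M) : Meq L M := Sum.inl a

/-- The class of the tuple `a` modulo the equivalence relation of the sort `S`. -/
def Meq.cls {L : FirstOrder.Language.{u, v}} {M : Type w} [L.Structure M] (S : ImagSort L M)
    (a : Fin S.arity → M) : Meq L M :=
  Sum.inr ⟨S, Quotient.mk S.setoid a⟩

/-- The symbols of the language `L^eq`.  The sorts are named by unary predicates, and (partial)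
functions between sorts are given by their graphs. -/
inductive EqSymbol (L : FirstOrder.Language.{u, v}) (M : Type w) [L.Structure M] : ℕ → Type (max u v w)
  /-- the home sort -/
  | home : EqSymbol L M 1
  /-- the imaginary sort `S` -/
  | sort (S : ImagSort L M) : EqSymbol L M 1
  /-- a relation symbol of `L`, on the home sort -/
  | rel {n : ℕ} (R : L.Relations n) : EqSymbol L M n
  /-- the graph of a function symbol of `L`, on the home sort -/
  | func {n : ℕ} (f : L.Functions n) : EqSymbol L M (n + 1)
  /-- the graph of the quotient map from `M^k` onto the imaginary sort `S` -/
  | proj (S : ImagSort L M) : EqSymbol L M (S.arity + 1)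

/-- The language `L^eq`. -/
def langEq (L : FirstOrder.Language.{u, v}) (M : Type w) [L.Structure M] : FirstOrder.Language.{0, max u v w} :=
  ⟨fun _ => Empty, EqSymbol L M⟩

/-- `M^eq` as an `L^eq`-structure. -/
instance (L : FirstOrder.Language.{u, v}) (M : Type w) [L.Structure M] : (langEq L M).Structure (Meq L M) where
  funMap f := f.elim
  RelMap {_} R :=
    match R with
    | .home => fun x => ∃ a : M, x 0 = Meq.real L a
    | .sort S => fun x => ∃ a : Fin S.arity → M, x 0 = Meq.cls S a
    | @EqSymbol.rel _ _ _ n R => fun x =>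
        ∃ a : Fin n → M, (∀ i, x i = Meq.real L (a i)) ∧ Structure.RelMap R a
    | @EqSymbol.func _ _ _ n f => fun x =>
        ∃ a : Fin n → M, (∀ i : Fin n, x i.castSucc = Meq.real L (a i)) ∧
          x (Fin.last n) = Meq.real L (Structure.funMap f a)
    | .proj S => fun x =>
        ∃ a : Fin S.arity → M, (∀ i : Fin S.arity, x i.castSucc = Meq.real L (a i)) ∧
          x (Fin.last S.arity) = Meq.cls S a

/-- The definable closure of `A`: all elements `b` such that `{b}` is definable over `A`. -/
def dcl (L : FirstOrder.Language.{u, v}) {M : Type w} [L.Structure M] (A : Set M) : Set M :=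
  {b | A.Definable₁ L {b}}

/-- The algebraic closure of `A`: all elements of finite sets that are definable over `A`. -/
def acl (L : FirstOrder.Language.{u, v}) {M : Type w} [L.Structure M] (A : Set M) : Set M :=
  {b | ∃ X : Set M, X.Finite ∧ A.Definable₁ L X ∧ b ∈ X}

/-- The theory `T` has weak elimination of imaginaries: for every imaginary element `e` (of `M^eq`,
for a model `M` of `T`) there is a finite tuple `a` of real elements such that `e` is in
`dcl^eq(a)` and `a` is in `acl^eq(e)`. -/
def WeakElimImaginaries {L : FirstOrder.Language.{u, v}} (T : L.Theory) : Prop :=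
  ∀ (M : Type w) [L.Structure M] [Nonempty M] [M ⊨ T] (e : Meq L M),
    ∃ (k : ℕ) (a : Fin k → M),
      e ∈ dcl (langEq L M) (Set.range fun i => Meq.real L (a i)) ∧
        ∀ i, Meq.real L (a i) ∈ acl (langEq L M) {e}

end Imaginaries

/-! ## Incidence structures and the theory `T_{m,n}` -/

namespace Incidence

/-- The symbols `P` (points), `L` (lines) and `I` (incidence). -/
inductive Symbol : ℕ → Type
  | point : Symbol 1
  | line : Symbol 1
  | inc : Symbol 2

/-- The language `{P, L, I}`. -/
def lang : FirstOrder.Language.{0, 0} := ⟨fun _ => Empty, Symbol⟩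

section Formulas

variable {α ι κ : Type}

/-- `P(x)` -/
def isPoint (x : α) : lang.Formula α :=
  Relations.formula₁ (L := lang) Symbol.point (Term.var x)

/-- `L(x)` -/
def isLine (x : α) : lang.Formula α :=
  Relations.formula₁ (L := lang) Symbol.line (Term.var x)

/-- `I(x, y)` -/
def incident (x y : α) : lang.Formula α :=
  Relations.formula₂ (L := lang) Symbol.inc (Term.var x) (Term.var y)

/-- `x = y` -/
def eqF (x y : α) : lang.Formula α :=
  Term.equal (Term.var x) (Term.var y)

/-- The variables `x i` are pairwise distinct. -/
noncomputable def distinct [Finite ι] (x : ι → α) : lang.Formula α :=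
  Formula.iInf fun p : {p : ι × ι // p.1 ≠ p.2} => ∼(eqF (x p.1.1) (x p.1.2))

/-- The `x i` are pairwise distinct points. -/
noncomputable def distinctPoints [Finite ι] (x : ι → α) : lang.Formula α :=
  distinct x ⊓ Formula.iInf fun i => isPoint (x i)

/-- The `y j` are pairwise distinct lines. -/
noncomputable def distinctLines [Finite κ] (y : κ → α) : lang.Formula α :=
  distinct y ⊓ Formula.iInf fun j => isLine (y j)

/-- Every `x i` is incident to every `y j`. -/
noncomputable def allIncident [Finite ι] [Finite κ] (x : ι → α) (y : κ → α) : lang.Formula α :=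
  Formula.iInf fun p : ι × κ => incident (x p.1) (y p.2)

end Formulas

/-- The axioms of incidence structures: `P` and `L` partition the domain, and `I` only holds between
a point and a line. -/
noncomputable def incidenceStructures : lang.Theory :=
  {Formula.iAlls (Fin 1) (isPoint (.inr 0) ⊔ isLine (.inr 0)),
   Formula.iAlls (Fin 1) (∼(isPoint (.inr 0) ⊓ isLine (.inr 0))),
   Formula.iAlls (Fin 2) (incident (.inr 0) (.inr 1) ⟹ isPoint (.inr 0) ⊓ isLine (.inr 1))}

/-- There are no `m` distinct points and `n` distinct lines such that every one of the points is
incident to every one of the lines. -/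
noncomputable def free (m n : ℕ) : lang.Sentence :=
  Formula.iAlls (Fin m ⊕ Fin n)
    (∼(distinctPoints (fun i : Fin m => Sum.inr (Sum.inl i)) ⊓
       distinctLines (fun j : Fin n => Sum.inr (Sum.inr j)) ⊓
       allIncident (fun i : Fin m => Sum.inr (Sum.inl i)) (fun j : Fin n => Sum.inr (Sum.inr j))))

/-- The theory `T^p_{m,n}` of `K_{m,n}`-free incidence structures. -/
noncomputable def Tp (m n : ℕ) : lang.Theory :=
  incidenceStructures ∪ {free m n}

/-- Any `m` distinct points simultaneously lie on (at least) `n - 1` distinct lines. -/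
noncomputable def enoughLines (m n : ℕ) : lang.Sentence :=
  Formula.iAlls (Fin m)
    (distinctPoints (fun i : Fin m => Sum.inr i) ⟹
      Formula.iExs (Fin (n - 1))
        (distinctLines (fun j : Fin (n - 1) => Sum.inr j) ⊓
          allIncident (fun i : Fin m => Sum.inl (Sum.inr i)) (fun j : Fin (n - 1) => Sum.inr j)))

/-- Any `n` distinct lines simultaneously contain (at least) `m - 1` distinct points. -/
noncomputable def enoughPoints (m n : ℕ) : lang.Sentence :=
  Formula.iAlls (Fin n)
    (distinctLines (fun j : Fin n => Sum.inr j) ⟹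
      Formula.iExs (Fin (m - 1))
        (distinctPoints (fun i : Fin (m - 1) => Sum.inr i) ⊓
          allIncident (fun i : Fin (m - 1) => Sum.inr i) (fun j : Fin n => Sum.inl (Sum.inr j))))

/-- The theory `T^c_{m,n}` of `K_{m,n}`-free incidence structures in which any `m` distinct points lie
on exactly `n - 1` common lines and any `n` distinct lines meet in exactly `m - 1` common points.
(By `K_{m,n}`-freeness, the number is never larger.) -/
noncomputable def Tc (m n : ℕ) : lang.Theory :=
  Tp m n ∪ {enoughLines m n, enoughPoints m n}

open Classical in
/-- The one of `φ` and `¬ φ` that is true in `A` under the labelling `e` of elements by variables. -/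
noncomputable def literal {A ι : Type} [lang.Structure A] (e : ι → A) (φ : lang.Formula ι) :
    lang.Formula ι :=
  if φ.Realize e then φ else ∼φ

/-- The diagram of the labelled elements `e i` of `A`: the conjunction of all atomic and negated
atomic formulas in the variables `ι` that are true of them in `A`. -/
noncomputable def diagram {A ι : Type} [lang.Structure A] [Finite ι] (e : ι → A) : lang.Formula ι :=
  (Formula.iInf fun p : ι × ι => literal e (eqF p.1 p.2)) ⊓
  (Formula.iInf fun i : ι => literal e (isPoint i)) ⊓
  (Formula.iInf fun i : ι => literal e (isLine i)) ⊓
  (Formula.iInf fun p : ι × ι => literal e (incident p.1 p.2))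

/-- A safe diagram `Δ(x; y)`, with `p` variables `x` and `q` variables `y`, given by a finite
`K_{m,n}`-free incidence structure whose elements are (bijectively) the variables `x, y`, such that
each point in `y` is incident to at most `n - 1` lines in `x`, and each line in `y` is incident to at
most `m - 1` points in `x`. -/
structure SafeDiagram (m n : ℕ) where
  /-- the number of variables `x` -/
  p : ℕ
  /-- the number of variables `y` -/
  q : ℕ
  /-- the structure on the variables -/
  str : lang.Structure (Fin p ⊕ Fin q)
  /-- it is a `K_{m,n}`-free incidence structure -/
  model : (Fin p ⊕ Fin q) ⊨ Tp m n
  /-- points in `y` -/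
  point_le : ∀ j : Fin q, (isPoint (Sum.inr j : Fin p ⊕ Fin q)).Realize id →
    {i : Fin p | (isLine (Sum.inl i : Fin p ⊕ Fin q)).Realize id ∧
      (incident (Sum.inr j) (Sum.inl i : Fin p ⊕ Fin q)).Realize id}.ncard ≤ n - 1
  /-- lines in `y` -/
  line_le : ∀ j : Fin q, (isLine (Sum.inr j : Fin p ⊕ Fin q)).Realize id →
    {i : Fin p | (isPoint (Sum.inl i : Fin p ⊕ Fin q)).Realize id ∧
      (incident (Sum.inl i) (Sum.inr j : Fin p ⊕ Fin q)).Realize id}.ncard ≤ m - 1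

namespace SafeDiagram

variable {m n : ℕ}

/-- The formula `Δ(x; y)`. -/
noncomputable def full (D : SafeDiagram m n) : lang.Formula (Fin D.p ⊕ Fin D.q) :=
  letI := D.str
  diagram (id : Fin D.p ⊕ Fin D.q → Fin D.p ⊕ Fin D.q)

/-- The part of `Δ` that only mentions the variables `x`. -/
noncomputable def restricted (D : SafeDiagram m n) : lang.Formula (Fin D.p) :=
  letI := D.str
  diagram (Sum.inl : Fin D.p → Fin D.p ⊕ Fin D.q)

/-- The sentence `∀ x (Δ'(x) → ∃ y Δ(x; y))`, where `Δ'` is the part of `Δ` in the variables `x`. -/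
noncomputable def extension (D : SafeDiagram m n) : lang.Sentence :=
  Formula.iAlls (Fin D.p)
    (D.restricted.relabel Sum.inr ⟹
      Formula.iExs (Fin D.q) (D.full.relabel (Sum.map Sum.inr id)))

end SafeDiagram

/-- The theory `T_{m,n}`. -/
noncomputable def T (m n : ℕ) : lang.Theory :=
  Tc m n ∪ Set.range (SafeDiagram.extension (m := m) (n := n))

end Incidence

-- View a model as a bipartite graph in which any `w c` vertices of colour `!c` have exactly `w (!c)
-- - 1` common neighbours. Repeatedly adding the vertices that have `w` of their colour many
-- neighbours in a set gives the finite-step closures `cl r`. They keep finite sets finite, with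
-- uniform bounds, and are preserved by partial isomorphisms (`image_cl`). The extension axioms
-- yield `free_extension`: a partial isomorphism on `D` extends to a finite `B ⊇ D` if `D` is closed
-- in `B`, with the new values free from any given finite set. A set `B` of bounded size cannot grow
-- at every step of a long chain, so some stage of a closure is closed in `B` (`exists_stationary`).
-- This replaces saturation, so everything happens inside an arbitrary model. In particular, the
-- truth of a formula depends only on the isomorphism type of a finite stage of the closure
-- (`exists_level_realize`).
--
-- Let `e` be the class of `a₀`, let `~` be its equivalence relation, and let `C` be the set of real
-- elements algebraic over `e`. Neumann's lemma (`exists_avoiding`), applied to the copies of a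
-- closure of `a₀` that have class `e`, gives `a₁ ~ a₀` whose closure meets that of `a₀` in `C`
-- only. A copy `a₂` of `a₀`, taken freely over a closure of `a₁`, is equivalent to `a₀` and has no
-- edges to it off `C` (`exists_level`). A further copy `a₃` of `a₀`, free over a closure of `a₂`,
-- satisfies `a₀ ~ a₂ ~ a₃`, and the closures of `a₀` and `a₃` have a union that is closed in the
-- finite set that matters. Hence any two copies of `a₀` over `C`, the second free from the first,
-- form an image of `(a₀, a₃)` along which `a₂` can be carried, and so they are equivalent. For an
-- arbitrary copy `a'` of `a₀` over `C`, choose a copy `b` free from both: `a₀ ~ b ~ a'`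
-- (`exists_level_of_free`). So `e` is the only class of copies of `cl s a₀` that fix the finite set
-- `C ∩ cl s a₀`, and is definable over that set.

universe u_1

/-! ## Definable predicates -/

namespace Imaginaries

/-- `p` is a predicate on `α`-tuples that is definable over `A`. -/
def DefPred (L : FirstOrder.Language.{u, v}) {M : Type w} [L.Structure M] (A : Set M) {α : Type*}
    (p : (α → M) → Prop) : Prop :=
  A.Definable L {x | p x}

namespace DefPred

variable {L : FirstOrder.Language.{u, v}} {M : Type w} [L.Structure M] {A : Set M}
  {α β ι : Type*}

theorem congr {p q : (α → M) → Prop} (hp : DefPred L A p) (h : ∀ x, q x ↔ p x) :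
    DefPred L A q := by
  have : q = p := funext fun x => propext (h x)
  rwa [this]

theorem not {p : (α → M) → Prop} (hp : DefPred L A p) : DefPred L A fun x => ¬ p x := by
  have := Set.Definable.compl hp
  rwa [Set.compl_ofPred] at this

theorem and {p q : (α → M) → Prop} (hp : DefPred L A p) (hq : DefPred L A q) :
    DefPred L A fun x => p x ∧ q x := by
  have := Set.Definable.inter hp hq
  rwa [show {x | p x} ∩ {x | q x} = {x | p x ∧ q x} by ext; simp] at this

theorem imp {p q : (α → M) → Prop} (hp : DefPred L A p) (hq : DefPred L A q) :
    DefPred L A fun x => p x → q x :=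
  (hp.and hq.not).not.congr fun x => by tauto

theorem iff_const {p : (α → M) → Prop} (hp : DefPred L A p) (c : Prop) :
    DefPred L A fun x => p x ↔ c := by
  by_cases hc : c
  · exact hp.congr fun x => by tauto
  · exact hp.not.congr fun x => by tauto

theorem all [Finite ι] {p : ι → (α → M) → Prop} (hp : ∀ i, DefPred L A (p i)) :
    DefPred L A fun x => ∀ i, p i x := by
  have := Set.definable_iInter_of_finite hp
  rwa [show ⋂ i, {x | p i x} = {x | ∀ i, p i x} by ext; simp] at this

theorem any [Finite ι] {p : ι → (α → M) → Prop} (hp : ∀ i, DefPred L A (p i)) :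
    DefPred L A fun x => ∃ i, p i x :=
  (all fun i => (hp i).not).not.congr fun x => by simp

theorem ex [Finite β] {p : (α → M) → (β → M) → Prop}
    (hp : DefPred L A fun v : α ⊕ β → M => p (v ∘ Sum.inl) (v ∘ Sum.inr)) :
    DefPred L A fun x => ∃ y, p x y := by
  have := Set.Definable.exists_of_finite hp
  refine congr this fun x => ?_
  simp

theorem forallTuple [Finite β] {p : (α → M) → (β → M) → Prop}
    (hp : DefPred L A fun v : α ⊕ β → M => p (v ∘ Sum.inl) (v ∘ Sum.inr)) :
    DefPred L A fun x => ∀ y, p x y :=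
  (ex (p := fun x y => ¬ p x y) hp.not).not.congr fun x => by simp

theorem comp {p : (α → M) → Prop} (hp : DefPred L A p) (f : α → β) :
    DefPred L A fun x : β → M => p (x ∘ f) :=
  Set.Definable.preimage_comp f hp

theorem mem {X : Set M} (hX : A.Definable₁ L X) (i : α) : DefPred L A fun x => x i ∈ X :=
  comp (p := fun x : Fin 1 → M => x 0 ∈ X) hX fun _ => i

theorem eq (i j : α) : DefPred L A fun x : α → M => x i = x j :=
  (Set.empty_definable_iff.2
    ⟨(Term.var i).equal (Term.var j), by ext; simp⟩ : (∅ : Set M).Definable L _).mono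
      (Set.empty_subset _)

theorem rel {n : ℕ} (R : L.Relations n) (s : Fin n → α) :
    DefPred L A fun x : α → M => Structure.RelMap R fun i => x (s i) :=
  (Set.empty_definable_iff.2
    ⟨R.formula fun i => Term.var (s i), by ext; simp [Formula.realize_rel]⟩ :
      (∅ : Set M).Definable L _).mono (Set.empty_subset _)

theorem const {a : M} (ha : a ∈ A) (i : α) : DefPred L A fun x : α → M => x i = a :=
  (mem (Set.Definable.singleton_of_mem L ha) i).congr fun _ => Iff.rfl

end DefPred

/-! ## Algebraic closure and avoidance of finite sets -/

section Avoid

variable {L : FirstOrder.Language.{u, v}} {M : Type w} [L.Structure M] {A : Set M}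

theorem subset_acl_of_finite {X : Set M} (hX : X.Finite) (hd : A.Definable₁ L X) : X ⊆ acl L A :=
  fun _ hb => ⟨X, hX, hd, hb⟩

theorem exists_finite_definable_of_mem_acl {ι : Type*} [Finite ι] {c : ι → M}
    (hc : ∀ i, c i ∈ acl L A) : ∃ X : Set M, X.Finite ∧ A.Definable₁ L X ∧ ∀ i, c i ∈ X := by
  choose X hX hd hb using hc
  refine ⟨⋃ i, X i, Set.finite_iUnion hX, ?_, fun i => Set.mem_iUnion.2 ⟨i, hb i⟩⟩
  have : DefPred L A fun x : Fin 1 → M => ∃ i, x 0 ∈ X i := DefPred.any fun i => hd i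
  exact this.congr fun x => Set.mem_iUnion

/-- The transversals of minimal size of a family of finite sets are finite in number. -/
theorem finite_minimal_transversals {N : Type*} (t : ℕ) (F : Set (Set N)) (hF : ∀ s ∈ F, s.Finite)
    (hmin : ∀ τ : Finset N, (∀ s ∈ F, ∃ x ∈ s, x ∈ τ) → t ≤ τ.card) :
    {τ : Finset N | (∀ s ∈ F, ∃ x ∈ s, x ∈ τ) ∧ τ.card ≤ t}.Finite := by
  classical
  induction t generalizing F with
  | zero =>
    refine (Set.finite_singleton (∅ : Finset N)).subset fun τ hτ => ?_
    simpa using hτ.2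
  | succ t ih =>
    -- A transversal contains one of the finitely many `x ∈ s`. Without `x` it is a transversal of
    -- the members that miss `x`, and those need at least `t` elements, since adding `x` back hits
    -- all of `F`.
    obtain ⟨s, hs⟩ : F.Nonempty := by
      by_contra h
      rw [Set.not_nonempty_iff_eq_empty] at h
      have := hmin ∅ (by simp [h])
      simp at this
    have hfin : ∀ x ∈ s, {τ : Finset N |
        (∀ s' ∈ {s' ∈ F | x ∉ s'}, ∃ y ∈ s', y ∈ τ) ∧ τ.card ≤ t}.Finite := by
      intro x _
      refine ih _ (fun s' h => hF s' h.1) fun τ hτ => ?_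
      have := hmin (insert x τ) fun s' hs' => ?_
      · have := this.trans (Finset.card_insert_le x τ)
        omega
      · by_cases hx : x ∈ s'
        · exact ⟨x, hx, by simp⟩
        · obtain ⟨y, hy, hyτ⟩ := hτ s' ⟨hs', hx⟩
          exact ⟨y, hy, by simp [hyτ]⟩
    refine ((hF s hs).biUnion fun x hx => (hfin x hx).image (insert x)).subset fun τ hτ => ?_
    obtain ⟨x, hx, hxτ⟩ := hτ.1 s hs
    refine Set.mem_biUnion hx ⟨τ.erase x, ⟨fun s' hs' => ?_, ?_⟩, Finset.insert_erase hxτ⟩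
    · obtain ⟨y, hy, hyτ⟩ := hτ.1 s' hs'.1
      refine ⟨y, hy, Finset.mem_erase.2 ⟨?_, hyτ⟩⟩
      rintro rfl
      exact hs'.2 hy
    · have := Finset.card_erase_of_mem hxτ
      have := hτ.2
      omega

/-- Neumann's lemma: the coordinates outside the algebraic closure of a member of a definable set
of tuples can be moved off a given finite set. -/
theorem exists_avoiding {ι : Type u_1} [Finite ι] {p : (ι → M) → Prop} (hp : DefPred L A p)
    {y₀ : ι → M} (hy₀ : p y₀) {F : Set M} (hF : F.Finite) :
    ∃ y, p y ∧ ∀ i, (y₀ i ∈ acl L A → y i = y₀ i) ∧ (y₀ i ∉ acl L A → y i ∉ F) := by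
  classical
  -- Otherwise every solution that agrees with `y₀` on its algebraic coordinates meets `F` in
  -- another coordinate. The hitting sets of minimal size `t` then fill out a finite definable set
  -- `W`.
  by_contra! hcon
  let J := {i // y₀ i ∈ acl L A}
  let J' := {i // y₀ i ∉ acl L A}
  obtain ⟨X, hXfin, hXdef, hX⟩ := exists_finite_definable_of_mem_acl
    (L := L) (A := A) (c := fun j : J => y₀ j) fun j => j.2
  let hits (c : J → M) (T : Set M) : Prop :=
    ∀ y, (p y ∧ ∀ j : J, y j = c j) → ∃ i : J', y i ∈ T
  let c₀ : J → M := fun j => y₀ j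
  have hex : ∃ t, ∃ τ : Finset M, hits c₀ τ ∧ τ.card = t := by
    refine ⟨_, hF.toFinset, fun y hy => ?_, rfl⟩
    obtain ⟨i, hi⟩ := hcon y hy.1
    by_cases hi' : y₀ i ∈ acl L A
    · exact absurd (hy.2 ⟨i, hi'⟩) (fun h => by
        have h1 : y i = y₀ i := h
        have := hi fun _ => h1
        exact this.1 hi')
    · have := (hi fun h => absurd h hi').2
      exact ⟨⟨i, hi'⟩, by simpa using this⟩
  let t := Nat.find hex
  obtain ⟨τ₀, hτ₀, hτ₀t⟩ := Nat.find_spec hex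
  let small (c : J → M) : Prop := ∀ k : Fin t, ∀ z : Fin k → M, ¬ hits c (Set.range z)
  -- The tuple `c₀` need not be definable over `A`, so `W` collects hitting sets for all `c` in the
  -- finite definable set `X`. The condition `small c` makes `t` minimal for `c` as well, which
  -- keeps their number finite.
  let W : Set M := {w | ∃ z : Fin t → M, (∃ j, w = z j) ∧ ∃ c : J → M, (∀ j, c j ∈ X) ∧
    hits c (Set.range z) ∧ small c}
  have hhits : ∀ (c : J → M), small c → ∀ τ : Finset M, hits c τ → t ≤ τ.card := by
    intro c hc τ hτ
    by_contra! hlt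
    refine hc ⟨τ.card, hlt⟩ (fun k => (τ.equivFin.symm k : M)) ?_
    convert hτ
    ext x
    simp only [Set.mem_range, SetLike.mem_coe]
    exact ⟨fun ⟨k, hk⟩ => hk ▸ (τ.equivFin.symm k).2, fun hx => ⟨τ.equivFin ⟨x, hx⟩, by simp⟩⟩
  have hWfin : W.Finite := by
    let fam (c : J → M) : Set (Set M) :=
      (fun y : ι → M => Set.range fun i : J' => y i) '' {y | p y ∧ ∀ j : J, y j = c j}
    have hfam : ∀ c (τ : Finset M), hits c τ ↔ ∀ s ∈ fam c, ∃ x ∈ s, x ∈ τ := by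
      intro c τ
      refine ⟨?_, fun h y hy => ?_⟩
      · rintro h _ ⟨y, hy, rfl⟩
        obtain ⟨i, hi⟩ := h y hy
        exact ⟨_, ⟨i, rfl⟩, hi⟩
      · obtain ⟨_, ⟨i, rfl⟩, hi⟩ := h _ ⟨y, hy, rfl⟩
        exact ⟨i, hi⟩
    have hcs : {c : J → M | ∀ j, c j ∈ X}.Finite := by
      have := Set.Finite.pi' (fun _ : J => hXfin)
      exact this
    have hfin : ∀ c, small c → {τ : Finset M | hits c τ ∧ τ.card ≤ t}.Finite := by
      intro c hc
      simp only [hfam]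
      refine finite_minimal_transversals t (fam c) ?_ fun τ hτ => hhits c hc τ ((hfam c τ).2 hτ)
      rintro _ ⟨y, -, rfl⟩
      exact Set.finite_range _
    refine (hcs.biUnion (t := fun c => ⋃ τ ∈ {τ : Finset M | small c ∧ hits c τ ∧ τ.card ≤ t},
      (τ : Set M)) fun c _ => ?_).subset ?_
    · refine Set.Finite.biUnion ?_ fun τ _ => τ.finite_toSet
      by_cases hc : small c
      · exact (hfin c hc).subset fun τ hτ => hτ.2
      · convert Set.finite_empty
        ext τ
        simp [hc]
    · rintro w ⟨z, ⟨j, rfl⟩, c, hcX, hz, hc⟩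
      refine Set.mem_biUnion hcX (Set.mem_biUnion (x := Finset.univ.image z) ⟨hc, ?_, ?_⟩ ?_)
      · simpa using hz
      · exact Finset.card_image_le.trans (by simp)
      · simp
  have hWdef : A.Definable₁ L W := by
    change DefPred L A fun x : Fin 1 → M => x 0 ∈ W
    have key : ∀ {γ : Type u_1} {k : ℕ} (f : J → γ) (g : Fin k → γ),
        DefPred L A fun x : γ → M => hits (fun j => x (f j)) (Set.range fun l => x (g l)) := by
      intro γ k f g
      refine DefPred.forallTuple (p := fun x y => (p y ∧ ∀ j : J, y j = x (f j)) →
        ∃ i : J', y i ∈ Set.range fun l => x (g l)) ?_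
      refine DefPred.imp ((hp.comp Sum.inr).and (DefPred.all fun j => DefPred.eq _ _)) ?_
      refine DefPred.any fun i => ?_
      refine (DefPred.any fun l => DefPred.eq (Sum.inl (g l)) (Sum.inr (i : ι))).congr fun x => ?_
      simp
    refine DefPred.ex (p := fun x z => (∃ j, x 0 = z j) ∧ ∃ c : J → M, (∀ j, c j ∈ X) ∧
      hits c (Set.range z) ∧ small c) ?_
    refine (DefPred.any fun j => DefPred.eq (Sum.inl 0) (Sum.inr j)).and ?_
    refine DefPred.ex (p := fun x c => (∀ j, c j ∈ X) ∧
      hits c (Set.range (x ∘ Sum.inr)) ∧ small c) ?_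
    refine (DefPred.all fun j => DefPred.mem hXdef (Sum.inr j)).and ((key _ _).and ?_)
    refine DefPred.all fun k => ?_
    refine DefPred.forallTuple (p := fun x (z : Fin k → M) =>
      ¬ hits (fun j => x (Sum.inr j)) (Set.range z)) ?_
    exact (key _ Sum.inr).not
  have hτW : ∀ x ∈ τ₀, x ∈ W := by
    intro x hx
    have e : Fin t ≃ τ₀ := (Fin.castOrderIso hτ₀t.symm).toEquiv.trans τ₀.equivFin.symm
    refine ⟨fun k => e k, ⟨e.symm ⟨x, hx⟩, by simp⟩, c₀, hX, ?_, ?_⟩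
    · convert hτ₀
      ext x
      simp only [Set.mem_range, SetLike.mem_coe]
      exact ⟨fun ⟨k, hk⟩ => hk ▸ (e k).2, fun hx => ⟨e.symm ⟨x, hx⟩, by simp⟩⟩
    · intro k z hz
      refine Nat.find_min hex (m := (Finset.univ.image z).card) ?_ ⟨_, by simpa using hz, rfl⟩
      exact (Finset.card_image_le.trans (by simp)).trans_lt k.2
  -- The solution `y₀` is hit as well, at a coordinate outside `acl`, although `τ₀ ⊆ W ⊆ acl`.
  obtain ⟨i, hi⟩ := hτ₀ y₀ ⟨hy₀, fun _ => rfl⟩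
  exact i.2 (subset_acl_of_finite hWfin hWdef (hτW _ hi))

end Avoid

end Imaginaries

/-! ## Bipartite graphs with a two-colouring -/

namespace Incidence

/-- A graph with a proper two-colouring: points have colour `true` and lines colour `false`. -/
structure IncGraph (V : Type*) where
  col : V → Bool
  adj : V → V → Prop
  symm : ∀ {x y}, adj x y → adj y x
  col_ne : ∀ {x y}, adj x y → col x ≠ col y

namespace IncGraph

variable {V V' : Type*} {G : IncGraph V} {H : IncGraph V'} {w : Bool → ℕ}

theorem col_eq_not {x y : V} (h : G.adj x y) : G.col y = !G.col x := by
  have := G.col_ne h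
  revert this
  cases G.col x <;> cases G.col y <;> simp

/-- `f` restricts to an isomorphism from `Q` onto its image. -/
structure EmbOn (G : IncGraph V) (H : IncGraph V') (f : V → V') (Q : Set V) : Prop where
  inj : Set.InjOn f Q
  col : ∀ x ∈ Q, H.col (f x) = G.col x
  adj : ∀ x ∈ Q, ∀ y ∈ Q, H.adj (f x) (f y) ↔ G.adj x y

namespace EmbOn

theorem mono {f : V → V'} {Q Q' : Set V} (h : EmbOn G H f Q) (hQ : Q' ⊆ Q) : EmbOn G H f Q' :=
  ⟨h.inj.mono hQ, fun x hx => h.col x (hQ hx), fun x hx y hy => h.adj x (hQ hx) y (hQ hy)⟩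

theorem id (G : IncGraph V) (Q : Set V) : EmbOn G G id Q :=
  ⟨Function.injective_id.injOn, fun _ _ => rfl, fun _ _ _ _ => Iff.rfl⟩

theorem exists_inverse [Nonempty V] {f : V → V'} {Q : Set V} (h : EmbOn G H f Q) :
    ∃ g : V' → V, EmbOn H G g (f '' Q) ∧ ∀ x ∈ Q, g (f x) = x := by
  have hinv : ∀ x ∈ Q, Function.invFunOn f Q (f x) = x := fun x hx => h.inj.leftInvOn_invFunOn hx
  refine ⟨Function.invFunOn f Q, ⟨?_, ?_, ?_⟩, hinv⟩
  · rintro _ ⟨x, hx, rfl⟩ _ ⟨y, hy, rfl⟩ hxy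
    rw [hinv x hx, hinv y hy] at hxy
    rw [hxy]
  · rintro _ ⟨x, hx, rfl⟩
    rw [hinv x hx, h.col x hx]
  · rintro _ ⟨x, hx, rfl⟩ _ ⟨y, hy, rfl⟩
    rw [hinv x hx, hinv y hy, h.adj x hx y hy]

end EmbOn

/-- There is no complete bipartite subgraph with `w false` points and `w true` lines. -/
def Free (G : IncGraph V) (w : Bool → ℕ) : Prop :=
  ∀ (c : Bool) (A B : Finset V), (∀ x ∈ A, G.col x = c) → (∀ y ∈ B, G.col y = !c) →
    (∀ x ∈ A, ∀ y ∈ B, G.adj x y) → w (!c) ≤ A.card → w c ≤ B.card → False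

/-- Any `w c` vertices of colour `!c` have at least `w (!c) - 1` common neighbours. -/
def Full (G : IncGraph V) (w : Bool → ℕ) : Prop :=
  ∀ (c : Bool) (B : Finset V), (∀ y ∈ B, G.col y = !c) → B.card = w c →
    ∃ A : Finset V, (∀ x ∈ A, G.col x = c ∧ ∀ y ∈ B, G.adj x y) ∧ w (!c) ≤ A.card + 1

/-- Safe finite free extensions of finite subgraphs are realised. -/
def Extends (G : IncGraph V) (w : Bool → ℕ) : Prop :=
  ∀ (p q : ℕ) (H : IncGraph (Fin p ⊕ Fin q)), H.Free w →
    (∀ (j : Fin q) (B : Finset (Fin p)), (∀ i ∈ B, H.adj (.inr j) (.inl i)) →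
      B.card < w (H.col (.inr j))) →
    ∀ a : Fin p → V, Function.Injective a → (∀ i, G.col (a i) = H.col (.inl i)) →
      (∀ i j, G.adj (a i) (a j) ↔ H.adj (.inl i) (.inl j)) →
      ∃ b : Fin q → V, EmbOn H G (Sum.elim a b) Set.univ

/-- The properties of models of `T_{m,n}`, as bipartite graphs. -/
structure Generic (G : IncGraph V) (w : Bool → ℕ) : Prop where
  pos : ∀ c, 1 ≤ w c
  free : G.Free w
  full : G.Full w
  ext : G.Extends w

/-- `x` is adjacent to at least `w (col x)` elements of `A`. -/
def Det (G : IncGraph V) (w : Bool → ℕ) (A : Set V) (x : V) : Prop :=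
  ∃ B : Finset V, ↑B ⊆ A ∧ B.card = w (G.col x) ∧ ∀ y ∈ B, G.adj x y

theorem Det.mono {A A' : Set V} {x : V} (h : G.Det w A x) (hA : A ⊆ A') : G.Det w A' x := by
  obtain ⟨B, hB, h⟩ := h
  exact ⟨B, hB.trans hA, h⟩

theorem Det.of_adj {A A' : Set V} {x : V} (h : G.Det w A x)
    (hA : ∀ y ∈ A, G.adj x y → y ∈ A') : G.Det w A' x := by
  obtain ⟨B, hB, hc, h⟩ := h
  exact ⟨B, fun y hy => hA y (hB hy) (h y hy), hc, h⟩

theorem Det.image {A Q : Set V} {f : V → V'} {x : V} (h : G.Det w A x) (hf : EmbOn G H f Q)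
    (hA : A ⊆ Q) (hx : x ∈ Q) : H.Det w (f '' A) (f x) := by
  classical
  obtain ⟨B, hB, hc, h⟩ := h
  refine ⟨B.image f, ?_, ?_, ?_⟩
  · rw [Finset.coe_image]
    exact Set.image_mono hB
  · rw [Finset.card_image_of_injOn (hf.inj.mono (hB.trans hA)), hc, hf.col x hx]
  · intro y hy
    obtain ⟨z, hz, rfl⟩ := Finset.mem_image.1 hy
    exact (hf.adj x hx z (hA (hB hz))).2 (h z hz)

theorem Det.of_image {A Q : Set V} {f : V → V'} {x : V} (h : H.Det w (f '' A) (f x))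
    (hf : EmbOn G H f Q) (hA : A ⊆ Q) (hx : x ∈ Q) : G.Det w A x := by
  have : Nonempty V := ⟨x⟩
  obtain ⟨g, hg, hgf⟩ := hf.exists_inverse
  have := h.image hg (Set.image_mono hA) (Set.mem_image_of_mem f hx)
  rwa [hgf x hx, Set.image_image, Set.image_congr fun y hy => hgf y (hA hy), Set.image_id'] at this

/-- One step of the closure. -/
def step (G : IncGraph V) (w : Bool → ℕ) (A : Set V) : Set V :=
  A ∪ {x | G.Det w A x}

/-- The `r`-step closure. -/
def cl (G : IncGraph V) (w : Bool → ℕ) (r : ℕ) (A : Set V) : Set V :=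
  (G.step w)^[r] A

theorem cl_succ (r : ℕ) (A : Set V) : G.cl w (r + 1) A = G.step w (G.cl w r A) :=
  Function.iterate_succ_apply' _ _ _

theorem det_cl {r : ℕ} {A : Set V} {x : V} (h : G.Det w (G.cl w r A) x) :
    x ∈ G.cl w (r + 1) A := by
  rw [cl_succ]
  exact Or.inr h

theorem cl_mono_right (A : Set V) : Monotone fun r => G.cl w r A :=
  monotone_nat_of_le_succ fun r => by
    rw [cl_succ]
    exact Set.subset_union_left

theorem subset_cl (r : ℕ) (A : Set V) : A ⊆ G.cl w r A :=
  cl_mono_right (G := G) (w := w) A (Nat.zero_le r)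

theorem step_mono {A B : Set V} (h : A ⊆ B) : G.step w A ⊆ G.step w B :=
  Set.union_subset_union h fun _ hx => hx.mono h

theorem cl_mono (r : ℕ) {A B : Set V} (h : A ⊆ B) : G.cl w r A ⊆ G.cl w r B := by
  induction r with
  | zero => exact h
  | succ r ih =>
    rw [cl_succ, cl_succ]
    exact step_mono ih

/-! ### Closures in generic graphs: invariance and finiteness -/

section Generic

variable (hG : G.Generic w)
include hG

/-- Fullness provides `w (!c) - 1` common neighbours of `w c` vertices in `A`, and `f` sends them to
common neighbours of the image. One more, outside the image, would complete a forbidden subgraph; so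
no surjectivity of `f` is needed. -/
theorem image_step {f : V → V} {A Q : Set V} (hf : EmbOn G G f Q) (hQ : G.step w A ⊆ Q) :
    f '' G.step w A = G.step w (f '' A) := by
  classical
  have hAQ : A ⊆ Q := Set.subset_union_left.trans hQ
  apply Set.Subset.antisymm
  · rintro _ ⟨x, hx, rfl⟩
    rcases id hx with hx' | hx'
    · exact Or.inl ⟨x, hx', rfl⟩
    · exact Or.inr (Det.image hx' hf hAQ (hQ hx))
  · rintro x (⟨x, hx, rfl⟩ | ⟨B', hB', hc, hadj⟩)
    · exact ⟨x, Or.inl hx, rfl⟩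
    · obtain ⟨B, hB, hBi⟩ : ∃ B : Finset V, ↑B ⊆ A ∧ B.image f = B' := by
        obtain ⟨B, hB, h⟩ := Finset.subset_set_image_iff.1 hB'
        exact ⟨B, hB, h⟩
      have hBQ := hB.trans hAQ
      have hBc : B.card = w (G.col x) := by
        rw [← hc, ← hBi, Finset.card_image_of_injOn (hf.inj.mono hBQ)]
      obtain ⟨A₁, hA₁, hA₁c⟩ := hG.full (G.col x) B (fun y hy => by
        rw [← hf.col y (hBQ hy)]
        exact col_eq_not (hadj _ (hBi ▸ Finset.mem_image_of_mem f hy))) hBc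
      have hA₁s : ↑A₁ ⊆ G.step w A := fun y hy =>
        Or.inr ⟨B, hB, by rw [hBc, (hA₁ y hy).1], (hA₁ y hy).2⟩
      by_contra hx
      have hxA : x ∉ A₁.image f := fun h => by
        obtain ⟨y, hy, rfl⟩ := Finset.mem_image.1 h
        exact hx ⟨y, hA₁s hy, rfl⟩
      refine hG.free (G.col x) (insert x (A₁.image f)) B' ?_ ?_ ?_ ?_ hc.ge
      · intro y hy
        rcases Finset.mem_insert.1 hy with rfl | hy
        · rfl
        · obtain ⟨z, hz, rfl⟩ := Finset.mem_image.1 hy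
          rw [hf.col z (hQ (hA₁s hz)), (hA₁ z hz).1]
      · exact fun y hy => col_eq_not (hadj y hy)
      · intro y hy z hz
        rcases Finset.mem_insert.1 hy with rfl | hy
        · exact hadj z hz
        · obtain ⟨y', hy', rfl⟩ := Finset.mem_image.1 hy
          rw [← hBi] at hz
          obtain ⟨z', hz', rfl⟩ := Finset.mem_image.1 hz
          exact (hf.adj y' (hQ (hA₁s hy')) z' (hBQ hz')).2 ((hA₁ y' hy').2 z' hz')
      · rw [Finset.card_insert_of_notMem hxA,
          Finset.card_image_of_injOn (hf.inj.mono (hA₁s.trans hQ))]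
        exact hA₁c

theorem image_cl {f : V → V} {A Q : Set V} (r : ℕ) (hf : EmbOn G G f Q) (hQ : G.cl w r A ⊆ Q) :
    f '' G.cl w r A = G.cl w r (f '' A) := by
  induction r with
  | zero => rfl
  | succ r ih =>
    rw [cl_succ] at hQ ⊢
    rw [cl_succ, image_step hG hf hQ, ih (Set.subset_union_left.trans hQ)]

/-- By `pos` the set `B` is nonempty if some `x` qualifies, so all such `x` have the same colour and
freeness bounds their number. The sum is a crude bound that does not depend on this colour. -/
theorem finite_card_det (B : Finset V) :
    {x | B.card = w (G.col x) ∧ ∀ y ∈ B, G.adj x y}.Finite ∧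
      {x | B.card = w (G.col x) ∧ ∀ y ∈ B, G.adj x y}.ncard ≤ w true + w false := by
  have key : ∀ T : Finset V, ↑T ⊆ {x | B.card = w (G.col x) ∧ ∀ y ∈ B, G.adj x y} →
      T.card ≤ w true + w false := by
    intro T hT
    by_contra! hlt
    obtain ⟨x, hx⟩ : T.Nonempty := Finset.card_pos.1 (by omega)
    have hB := hG.pos (G.col x)
    rw [← (hT hx).1] at hB
    obtain ⟨b, hb⟩ := Finset.card_pos.1 hB
    refine hG.free (G.col x) T B (fun y hy => ?_) (fun y hy => ?_)
      (fun y hy => (hT hy).2) ?_ (hT hx).1.ge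
    · rw [col_eq_not (G.symm ((hT hx).2 b hb)), col_eq_not (G.symm ((hT hy).2 b hb))]
    · exact col_eq_not ((hT hx).2 y hy)
    · cases G.col x <;> simp <;> omega
  have hfin : {x | B.card = w (G.col x) ∧ ∀ y ∈ B, G.adj x y}.Finite := by
    by_contra h
    obtain ⟨T, hT, hc⟩ := Set.Infinite.exists_subset_card_eq h (w true + w false + 1)
    have := key T hT
    omega
  refine ⟨hfin, ?_⟩
  rw [Set.ncard_eq_toFinset_card _ hfin]
  exact key _ (by simp)

theorem exists_card_step_le (k : ℕ) : ∃ N, ∀ A : Set V, A.Finite → A.ncard ≤ k →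
    (G.step w A).Finite ∧ (G.step w A).ncard ≤ N := by
  classical
  -- The factor `2 ^ k` counts the subsets `B` of `A`.
  refine ⟨k + 2 ^ k * (w true + w false), fun A hA hk => ?_⟩
  have hA' : A = hA.toFinset := by simp
  rw [Set.ncard_eq_toFinset_card _ hA] at hk
  let S := hA.toFinset ∪ hA.toFinset.powerset.biUnion fun B => (finite_card_det hG B).1.toFinset
  have hS : G.step w A ⊆ S := by
    rintro x (hx | ⟨B, hB, hx⟩)
    · simp [S, hx]
    · simp only [S, Finset.coe_union, Finset.coe_biUnion]
      refine Or.inr (Set.mem_biUnion (x := B) ?_ ?_)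
      · rw [Finset.mem_coe, Finset.mem_powerset]
        exact fun y hy => hA.mem_toFinset.2 (hB hy)
      · simpa using hx
  refine ⟨S.finite_toSet.subset hS, (Set.ncard_le_ncard hS S.finite_toSet).trans ?_⟩
  rw [Set.ncard_coe_finset]
  refine (Finset.card_union_le _ _).trans (add_le_add hk ?_)
  refine (Finset.card_biUnion_le_card_mul _ _ (w true + w false) fun B _ => ?_).trans ?_
  · rw [← Set.ncard_eq_toFinset_card _ (finite_card_det hG B).1]
    exact (finite_card_det hG B).2
  · rw [Finset.card_powerset]
    exact Nat.mul_le_mul_right _ (Nat.pow_le_pow_right (by norm_num) hk)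

theorem exists_card_cl_le (r k : ℕ) : ∃ N, ∀ A : Set V, A.Finite → A.ncard ≤ k →
    (G.cl w r A).Finite ∧ (G.cl w r A).ncard ≤ N := by
  induction r with
  | zero => exact ⟨k, fun A hA hk => ⟨hA, hk⟩⟩
  | succ r ih =>
    obtain ⟨N, hN⟩ := ih
    obtain ⟨N', hN'⟩ := exists_card_step_le hG N
    refine ⟨N', fun A hA hk => ?_⟩
    rw [cl_succ]
    exact hN' _ (hN A hA hk).1 (hN A hA hk).2

theorem finite_cl (r : ℕ) {A : Set V} (hA : A.Finite) : (G.cl w r A).Finite := by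
  obtain ⟨N, hN⟩ := exists_card_cl_le hG r A.ncard
  exact (hN A hA le_rfl).1

end Generic

/-! ### Pigeonhole for chains of sets -/

theorem ncard_range_le {ι X : Type*} [Finite ι] (a : ι → X) : (Set.range a).ncard ≤ Nat.card ι := by
  rw [← Set.image_univ, ← Set.ncard_univ]
  exact Set.ncard_image_le Set.finite_univ

/-- A finite set meets some difference of consecutive members of a long chain trivially. -/
theorem exists_stationary {X : Type*} {S : ℕ → Set X} (hS : Monotone S) {B : Set X}
    (hB : B.Finite) {N : ℕ} (hN : B.ncard ≤ N) (t : ℕ) :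
    ∃ s, t ≤ s ∧ s ≤ t + N ∧ B ∩ S (s + 1) ⊆ S s := by
  -- Otherwise each of the `N + 1` steps from `t` on adds an element of `B`, which has at most `N`.
  by_contra! h
  have key : ∀ i, i ≤ N + 1 → i ≤ (B ∩ S (t + i)).ncard := by
    intro i hi
    induction i with
    | zero => simp
    | succ i ih =>
      have h1 := ih (by omega)
      have h2 : (B ∩ S (t + i)).ncard < (B ∩ S (t + (i + 1))).ncard := by
        refine Set.ncard_lt_ncard ⟨Set.inter_subset_inter_right _ (hS (by omega)), fun hsub => ?_⟩
          (hB.subset Set.inter_subset_left)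
        exact h (t + i) (by omega) (by omega) (hsub.trans Set.inter_subset_right)
      omega
  have := key (N + 1) le_rfl
  have := Set.ncard_le_ncard (Set.inter_subset_left (s := B) (t := S (t + (N + 1)))) hB
  omega

/-- A version of `exists_stationary` for two chains. -/
theorem exists_stationary₂ {X : Type*} {S S' : ℕ → Set X} (hS : Monotone S) (hS' : Monotone S')
    {B : Set X} (hB : B.Finite) {N : ℕ} (hN : B.ncard ≤ N) :
    ∃ s, s ≤ 2 * N ∧ B ∩ S (s + 1) ⊆ S s ∧ B ∩ S' (s + 1) ⊆ S' s := by
  -- A Boolean tag merges the two chains into one; `B` is doubled, hence the bound `2 * N`.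
  obtain ⟨s, -, hs, h⟩ := exists_stationary
    (S := fun s => {x : X × Bool | x.1 ∈ if x.2 then S s else S' s}) (B := B ×ˢ Set.univ)
    (N := 2 * N) (fun i j hij x hx => by
      rcases x with ⟨x, _ | _⟩
      · exact hS' hij hx
      · exact hS hij hx) (hB.prod Set.finite_univ) (by
      rw [Set.ncard_prod, Set.ncard_univ]
      simp
      omega) 0
  refine ⟨s, by omega, fun x hx => ?_, fun x hx => ?_⟩
  · exact h (a := (x, true)) ⟨⟨hx.1, trivial⟩, hx.2⟩
  · exact h (a := (x, false)) ⟨⟨hx.1, trivial⟩, hx.2⟩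

end IncGraph

end Incidence

/-! ### Free amalgams and extension of partial isomorphisms -/

namespace Incidence

namespace IncGraph

variable {V V' : Type*} {G : IncGraph V} {H : IncGraph V'} {w : Bool → ℕ}

/-- Only the one complete bipartite subgraph has to lie in `Q`, so different subgraphs of an amalgam
can be excluded by different partial embeddings. -/
theorem Free.of_embOn {f : V → V'} {Q : Set V} (hH : H.Free w) (hf : EmbOn G H f Q) (c : Bool)
    (A B : Finset V) (hA : ∀ x ∈ A, G.col x = c) (hB : ∀ y ∈ B, G.col y = !c)
    (hAB : ∀ x ∈ A, ∀ y ∈ B, G.adj x y) (hAc : w (!c) ≤ A.card) (hBc : w c ≤ B.card)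
    (hAQ : ↑A ⊆ Q) (hBQ : ↑B ⊆ Q) : False := by
  classical
  refine hH c (A.image f) (B.image f) ?_ ?_ ?_ ?_ ?_
  · simp only [Finset.forall_mem_image]
    exact fun x hx => by rw [hf.col x (hAQ hx), hA x hx]
  · simp only [Finset.forall_mem_image]
    exact fun x hx => by rw [hf.col x (hBQ hx), hB x hx]
  · simp only [Finset.forall_mem_image]
    exact fun x hx y hy => (hf.adj x (hAQ hx) y (hBQ hy)).2 (hAB x hx y hy)
  · rwa [Finset.card_image_of_injOn (hf.inj.mono hAQ)]
  · rwa [Finset.card_image_of_injOn (hf.inj.mono hBQ)]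

/-- The free amalgam of two induced subgraphs of `G`, given by labellings `a` and `b` of their
vertices, over the partial isomorphism `f` with domain `D`; the elements of `D` are labelled
by `a` through `f`. -/
def amalgam {ι κ : Type*} (G : IncGraph V) (f : V → V) (D : Set V)
    (hf : EmbOn G G f D) (a : ι → V) (b : κ → V) : IncGraph (ι ⊕ κ) where
  col := Sum.elim (G.col ∘ a) (G.col ∘ b)
  adj
    | .inl i, .inl j => G.adj (a i) (a j)
    | .inr i, .inr j => G.adj (b i) (b j)
    | .inl i, .inr j => ∃ d ∈ D, f d = a i ∧ G.adj d (b j)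
    | .inr j, .inl i => ∃ d ∈ D, f d = a i ∧ G.adj d (b j)
  symm {x y} h := by
    rcases x with i | i <;> rcases y with j | j
    · exact G.symm h
    · exact h
    · exact h
    · exact G.symm h
  col_ne {x y} h := by
    rcases x with i | i <;> rcases y with j | j
    · exact G.col_ne h
    · obtain ⟨d, hd, hda, h⟩ := h
      have := G.col_ne h
      simpa [← hda, hf.col d hd] using this
    · obtain ⟨d, hd, hda, h⟩ := h
      have := G.col_ne h
      simpa [← hda, hf.col d hd] using this.symm
    · exact G.col_ne h

section Generic

variable (hG : G.Generic w)
include hG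

/-- A forbidden subgraph cannot lie in one half, as each half embeds in `G`. So it has a left vertex
off the base and a right vertex; these are not adjacent, hence on the same side. The other side then
consists of base vertices, and they determine the right vertex over `D`, against `hclosed`. -/
theorem free_amalgam {ι κ : Type*} {f : V → V} {D : Set V}
    (hf : EmbOn G G f D) {a : ι → V} {b : κ → V} (ha : a.Injective) (hb : b.Injective)
    (hbD : ∀ j, b j ∉ D) (hclosed : ∀ j, ¬ G.Det w D (b j)) :
    (G.amalgam f D hf a b).Free w := by
  classical
  by_cases hne : Nonempty V
  swap
  · intro c A B _ _ _ hA _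
    obtain ⟨x, -⟩ := Finset.card_pos.1 ((hG.pos _).trans hA)
    rcases x with i | j
    · exact hne ⟨a i⟩
    · exact hne ⟨b j⟩
  obtain ⟨g, hg, hgf⟩ := hf.exists_inverse
  have hembL : EmbOn (G.amalgam f D hf a b) G (Sum.elim a fun _ => Classical.arbitrary V)
      {x | x.isLeft} := by
    refine ⟨?_, ?_, ?_⟩
    · rintro (i | i) hi (j | j) hj h
      · exact congrArg _ (ha h)
      all_goals simp at hi hj
    · rintro (i | i) hi
      · rfl
      · simp at hi
    · rintro (i | i) hi (j | j) hj
      · exact Iff.rfl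
      all_goals simp at hi hj
  -- The right half together with the base, whose labels in `f '' D` are pulled back to `D` by `g`.
  let QR : Set (ι ⊕ κ) := {x | ∀ i, x = .inl i → a i ∈ f '' D}
  have hembR : EmbOn (G.amalgam f D hf a b) G (Sum.elim (g ∘ a) b) QR := by
    have hga : ∀ i, (.inl i : ι ⊕ κ) ∈ QR → ∃ d ∈ D, f d = a i ∧ g (a i) = d := by
      intro i hi
      obtain ⟨d, hd, h⟩ := hi i rfl
      exact ⟨d, hd, h, by rw [← h, hgf d hd]⟩
    refine ⟨?_, ?_, ?_⟩
    · rintro (i | i) hi (j | j) hj h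
      · obtain ⟨d, hd, h1, h2⟩ := hga i hi
        obtain ⟨d', hd', h1', h2'⟩ := hga j hj
        simp only [Sum.elim_inl, Function.comp_apply, h2, h2'] at h
        exact congrArg _ (ha (by rw [← h1, ← h1', h]))
      · obtain ⟨d, hd, h1, h2⟩ := hga i hi
        simp only [Sum.elim_inl, Sum.elim_inr, Function.comp_apply, h2] at h
        exact absurd (h ▸ hd) (hbD j)
      · obtain ⟨d, hd, h1, h2⟩ := hga j hj
        simp only [Sum.elim_inl, Sum.elim_inr, Function.comp_apply, h2] at h
        exact absurd (h.symm ▸ hd) (hbD i)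
      · exact congrArg _ (hb h)
    · rintro (i | i) hi
      · obtain ⟨d, hd, h1, h2⟩ := hga i hi
        change G.col (g (a i)) = G.col (a i)
        rw [h2, ← h1, hf.col d hd]
      · rfl
    · have hmix : ∀ i j, (.inl i : ι ⊕ κ) ∈ QR →
          (G.adj (g (a i)) (b j) ↔ ∃ d ∈ D, f d = a i ∧ G.adj d (b j)) := by
        intro i j hi
        obtain ⟨d, hd, h1, h2⟩ := hga i hi
        rw [h2]
        refine ⟨fun h => ⟨d, hd, h1, h⟩, ?_⟩
        rintro ⟨d', hd', h1', h⟩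
        rwa [hf.inj hd hd' (h1.trans h1'.symm)]
      rintro (i | i) hi (j | j) hj
      · obtain ⟨d, hd, h1, h2⟩ := hga i hi
        obtain ⟨d', hd', h1', h2'⟩ := hga j hj
        change G.adj (g (a i)) (g (a j)) ↔ G.adj (a i) (a j)
        rw [h2, h2', ← h1, ← h1', hf.adj d hd d' hd']
      · exact hmix i j hi
      · exact (⟨G.symm, G.symm⟩ : G.adj (b i) (g (a j)) ↔ G.adj (g (a j)) (b i)).trans
          (hmix j i hj)
      · exact Iff.rfl
  -- A side containing both a left vertex off the base and a right vertex is impossible.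
  have hmixed : ∀ c (A B : Finset (ι ⊕ κ)), (∀ x ∈ A, (G.amalgam f D hf a b).col x = c) →
      (∀ x ∈ A, ∀ y ∈ B, (G.amalgam f D hf a b).adj x y) → w c ≤ B.card →
      ∀ i j, (.inl i : ι ⊕ κ) ∈ A → a i ∉ f '' D → (.inr j : ι ⊕ κ) ∈ A → False := by
    intro c A B hA hAB hBc i j hi hiD hj
    have hBl : ∀ y ∈ B, ∃ i', y = .inl i' ∧ ∃ d ∈ D, f d = a i' ∧ G.adj d (b j) := by
      rintro (i' | j') hy
      · exact ⟨i', rfl, hAB _ hj _ hy⟩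
      · obtain ⟨d, hd, h, -⟩ := hAB _ hi _ hy
        exact absurd ⟨d, hd, h⟩ hiD
    have hBQ : ↑B ⊆ QR := by
      intro y hy i' hyi
      obtain ⟨i'', rfl, d, hd, h, -⟩ := hBl y hy
      cases hyi
      exact ⟨d, hd, h⟩
    obtain ⟨B', hB'B, hB'c⟩ := Finset.exists_subset_card_eq hBc
    refine hclosed j ⟨B'.image (Sum.elim (g ∘ a) b), ?_, ?_, ?_⟩
    · intro x hx
      obtain ⟨y, hy, rfl⟩ := Finset.mem_image.1 (Finset.mem_coe.1 hx)
      obtain ⟨i', rfl, d, hd, h, -⟩ := hBl y (hB'B hy)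
      simpa [← h, hgf d hd] using hd
    · rw [Finset.card_image_of_injOn (hembR.inj.mono fun x hx => hBQ (hB'B hx)), hB'c]
      exact congrArg w (hA _ hj).symm
    · intro x hx
      obtain ⟨y, hy, rfl⟩ := Finset.mem_image.1 hx
      obtain ⟨i', rfl, d, hd, h, hadj⟩ := hBl y (hB'B hy)
      simpa [← h, hgf d hd] using G.symm hadj
  intro c A B hA hB hAB hAc hBc
  by_cases hl : ∃ i, (.inl i ∈ A ∨ .inl i ∈ B) ∧ a i ∉ f '' D
  · by_cases hr : ∃ j, .inr j ∈ A ∨ .inr j ∈ B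
    · obtain ⟨i, hi, hiD⟩ := hl
      obtain ⟨j, hj⟩ := hr
      rcases hi with hi | hi <;> rcases hj with hj | hj
      · exact hmixed c A B hA hAB hBc i j hi hiD hj
      · obtain ⟨d, hd, h, -⟩ := hAB _ hi _ hj
        exact hiD ⟨d, hd, h⟩
      · obtain ⟨d, hd, h, -⟩ := hAB _ hj _ hi
        exact hiD ⟨d, hd, h⟩
      · exact hmixed (!c) B A hB (fun x hx y hy => (G.amalgam f D hf a b).symm (hAB y hy x hx))
          hAc i j hi hiD hj
    · push Not at hr
      refine hG.free.of_embOn hembL c A B hA hB hAB hAc hBc ?_ ?_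
      · rintro (i | j) hx
        · rfl
        · exact absurd hx (hr j).1
      · rintro (i | j) hx
        · rfl
        · exact absurd hx (hr j).2
  · push Not at hl
    refine hG.free.of_embOn hembR c A B hA hB hAB hAc hBc ?_ ?_
    · rintro x hx i rfl
      exact hl i (Or.inl hx)
    · rintro x hx i rfl
      exact hl i (Or.inr hx)

/-- A partial isomorphism defined on a subset `D` of `B` that is closed in `B` extends to `B`, so
that the new values are free from a given finite set over the image of `D`. -/
theorem free_extension {f : V → V} {D B F : Set V} (hB : B.Finite)
    (hclosed : ∀ x ∈ B, G.Det w D x → x ∈ D) (hf : EmbOn G G f D) (hF : F.Finite)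
    (hfF : f '' D ⊆ F) :
    ∃ g, Set.EqOn g f D ∧ EmbOn G G g B ∧
      ∀ x ∈ B, x ∉ D → g x ∉ F ∧ ∀ y ∈ F, G.adj (g x) y → y ∈ f '' D := by
  classical
  have hX : (B \ D).Finite := hB.subset Set.sdiff_subset
  have := hF.fintype
  have := hX.fintype
  let eF := (Fintype.equivFin F).symm
  let eX := (Fintype.equivFin ↥(B \ D)).symm
  let a : Fin (Fintype.card F) → V := fun i => eF i
  let b : Fin (Fintype.card ↥(B \ D)) → V := fun i => eX i
  have ha : a.Injective := Subtype.val_injective.comp eF.injective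
  have hb : b.Injective := Subtype.val_injective.comp eX.injective
  have hb' : ∀ j, b j ∈ B \ D := fun j => (eX j).2
  -- The old part of the diagram is all of `F`, not only `f '' D`, so that the free amalgam forbids
  -- edges from new vertices to the rest of `F`. It is safe: too many old neighbours of a new vertex
  -- would pull back to `D` and determine it.
  obtain ⟨b', hb'e⟩ := hG.ext _ _ (G.amalgam f D hf a b)
    (free_amalgam hG hf ha hb (fun j => (hb' j).2) fun j h => (hb' j).2 (hclosed _ (hb' j).1 h))
    (by
      intro j S hS
      by_contra! hle
      obtain ⟨S', hS', hS'c⟩ := Finset.exists_subset_card_eq hle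
      have : Nonempty V := ⟨b j⟩
      choose! d hd hda hadj using hS
      refine (hb' j).2 (hclosed _ (hb' j).1 ⟨S'.image d, ?_, ?_, ?_⟩)
      · intro x hx
        obtain ⟨y, hy, rfl⟩ := Finset.mem_image.1 (Finset.mem_coe.1 hx)
        exact hd y (hS' hy)
      · rw [Finset.card_image_of_injOn, hS'c]
        · rfl
        · intro x hx y hy hxy
          exact ha (by rw [← hda x (hS' hx), ← hda y (hS' hy), hxy])
      · intro x hx
        obtain ⟨y, hy, rfl⟩ := Finset.mem_image.1 hx
        exact G.symm (hadj y (hS' hy)))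
    a ha (fun i => rfl) (fun i j => Iff.rfl)
  let g : V → V := fun x => if hx : x ∈ B \ D then b' (eX.symm ⟨x, hx⟩) else f x
  have hgD : Set.EqOn g f D := fun x hx => dif_neg fun h => h.2 hx
  have hgX : ∀ j, g (b j) = b' j := fun j => by
    have : eX.symm ⟨b j, hb' j⟩ = j := eX.symm_apply_apply j
    simp only [g, dif_pos (hb' j), this]
  have hbX : ∀ x ∈ B, x ∉ D → ∃ j, b j = x := fun x hx hxD => ⟨eX.symm ⟨x, hx, hxD⟩, by simp [b]⟩
  have haF : ∀ x ∈ F, ∃ i, a i = x := fun x hx => ⟨eF.symm ⟨x, hx⟩, by simp [a]⟩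
  have hmix : ∀ d ∈ D, ∀ j, (G.adj (f d) (b' j) ↔ G.adj d (b j)) := by
    intro d hd j
    obtain ⟨i, hi⟩ := haF (f d) (hfF ⟨d, hd, rfl⟩)
    have := hb'e.adj (.inl i) trivial (.inr j) trivial
    rw [Sum.elim_inl, Sum.elim_inr, hi] at this
    rw [this]
    refine ⟨?_, fun h => ⟨d, hd, hi.symm, h⟩⟩
    rintro ⟨d', hd', h1', h⟩
    rwa [hf.inj hd hd' (hi.symm.trans h1'.symm)]
  have hnF : ∀ j, b' j ∉ F := by
    intro j hj
    obtain ⟨i, hi⟩ := haF _ hj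
    have := hb'e.inj (x₁ := .inl i) (x₂ := .inr j) trivial trivial hi
    cases this
  refine ⟨g, hgD, ⟨?_, ?_, ?_⟩, ?_⟩
  · intro x hx y hy hxy
    by_cases hxD : x ∈ D <;> by_cases hyD : y ∈ D
    · rw [hgD hxD, hgD hyD] at hxy
      exact hf.inj hxD hyD hxy
    · obtain ⟨j, rfl⟩ := hbX y hy hyD
      rw [hgD hxD, hgX] at hxy
      exact absurd (hfF ⟨x, hxD, hxy⟩) (hnF j)
    · obtain ⟨j, rfl⟩ := hbX x hx hxD
      rw [hgD hyD, hgX] at hxy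
      exact absurd (hfF ⟨y, hyD, hxy.symm⟩) (hnF j)
    · obtain ⟨i, rfl⟩ := hbX x hx hxD
      obtain ⟨j, rfl⟩ := hbX y hy hyD
      rw [hgX, hgX] at hxy
      have := hb'e.inj (x₁ := .inr i) (x₂ := .inr j) trivial trivial hxy
      cases this
      rfl
  · intro x hx
    by_cases hxD : x ∈ D
    · rw [hgD hxD, hf.col x hxD]
    · obtain ⟨j, rfl⟩ := hbX x hx hxD
      rw [hgX]
      exact hb'e.col (.inr j) trivial
  · intro x hx y hy
    by_cases hxD : x ∈ D <;> by_cases hyD : y ∈ D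
    · rw [hgD hxD, hgD hyD, hf.adj x hxD y hyD]
    · obtain ⟨j, rfl⟩ := hbX y hy hyD
      rw [hgD hxD, hgX, hmix x hxD]
    · obtain ⟨j, rfl⟩ := hbX x hx hxD
      rw [hgD hyD, hgX]
      exact ⟨fun h => G.symm ((hmix y hyD j).1 (G.symm h)),
        fun h => G.symm ((hmix y hyD j).2 (G.symm h))⟩
    · obtain ⟨i, rfl⟩ := hbX x hx hxD
      obtain ⟨j, rfl⟩ := hbX y hy hyD
      rw [hgX, hgX]
      exact hb'e.adj (.inr i) trivial (.inr j) trivial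
  · intro x hx hxD
    obtain ⟨j, rfl⟩ := hbX x hx hxD
    rw [hgX]
    refine ⟨hnF j, fun y hy h => ?_⟩
    obtain ⟨i, rfl⟩ := haF y hy
    obtain ⟨d, hd, hda, -⟩ := (hb'e.adj (.inr j) trivial (.inl i) trivial).1 h
    exact ⟨d, hd, hda⟩

end Generic

end IncGraph

end Incidence

/-! ### Equivalent tuples that are free from each other -/

namespace Incidence

namespace IncGraph

variable {V : Type*} {G : IncGraph V} {w : Bool → ℕ}

/-- Two partial isomorphisms that are free from each other over the common part of their domains
can be glued. -/
theorem EmbOn.glue {A U C D F : Set V} {g f k : V → V} (hAU : A ⊆ U) (hg : EmbOn G G g U)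
    (hgD : ∀ x ∈ D, g x = x) (hgU : ∀ x ∈ U, x ∉ D → g x ∉ U ∧ ∀ y ∈ U, G.adj (g x) y → y ∈ D)
    (hCD : ∀ x ∈ A, x ∈ C ↔ x ∈ D) (hf : EmbOn G G f A) (hfC : ∀ x ∈ A, x ∈ C → f x = x)
    (hfF : f '' A ⊆ F) (hk : EmbOn G G k A) (hkC : ∀ x ∈ A, x ∈ C → k x = x)
    (hkF : ∀ x ∈ A, x ∉ C → k x ∉ F ∧ ∀ y ∈ F, G.adj (k x) y → y ∈ A ∩ C) :
    ∃ h, EmbOn G G h (A ∪ g '' A) ∧ (∀ x ∈ A, h x = f x) ∧ ∀ x ∈ A, h (g x) = k x := by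
  classical
  rcases isEmpty_or_nonempty V with hV | hV
  · exact ⟨_root_.id, EmbOn.id _ _, fun x => hV.elim x, fun x => hV.elim x⟩
  obtain ⟨g', -, hg'⟩ := hg.exists_inverse
  let h : V → V := fun x => if x ∈ A then f x else k (g' x)
  have h1 : ∀ x ∈ A, h x = f x := fun x hx => if_pos hx
  have h2 : ∀ x ∈ A, h (g x) = k x := by
    intro x hx
    by_cases hxD : x ∈ D
    · have hxC := (hCD x hx).2 hxD
      rw [hgD x hxD, h1 x hx, hfC x hx hxC, hkC x hx hxC]
    · have : g x ∉ A := fun h => (hgU x (hAU hx) hxD).1 (hAU h)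
      simp only [h, if_neg this, hg' x (hAU hx)]
  have hcover : ∀ x ∈ A ∪ g '' A, x ∈ A ∨ ∃ z ∈ A, z ∉ C ∧ g z = x := by
    rintro x (hx | ⟨z, hz, rfl⟩)
    · exact Or.inl hx
    · by_cases hzC : z ∈ C
      · rw [hgD z ((hCD z hz).1 hzC)]
        exact Or.inl hz
      · exact Or.inr ⟨z, hz, hzC, rfl⟩
  -- On both sides an edge forces `x ∈ C`, where `f`, `g` and `k` are all the identity. On the left
  -- side one first gets `f x ∈ A ∩ C`; then `f` fixes `f x`, and `f x = x` by injectivity.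
  have hmix : ∀ x ∈ A, ∀ z ∈ A, z ∉ C → (G.adj (f x) (k z) ↔ G.adj x (g z)) := by
    intro x hx z hz hzC
    have hx' : x ∈ C → (G.adj (f x) (k z) ↔ G.adj x (g z)) := by
      intro hxC
      rw [hfC x hx hxC]
      have e1 := hk.adj x hx z hz
      have e2 := hg.adj x (hAU hx) z (hAU hz)
      rw [hkC x hx hxC] at e1
      rw [hgD x ((hCD x hx).1 hxC)] at e2
      rw [e1, e2]
    constructor
    · intro hadj
      have := (hkF z hz hzC).2 (f x) (hfF ⟨x, hx, rfl⟩) (G.symm hadj)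
      have hxe : f x = x := hf.inj this.1 hx (hfC _ this.1 this.2)
      exact (hx' (hxe ▸ this.2)).1 hadj
    · intro hadj
      have := (hgU z (hAU hz) fun h => hzC ((hCD z hz).2 h)).2 x (hAU hx) (G.symm hadj)
      exact (hx' ((hCD x hx).2 this)).2 hadj
  refine ⟨h, ⟨?_, ?_, ?_⟩, h1, h2⟩
  · intro x hxX y hyX hxy
    rcases hcover x hxX with hx | ⟨x, hx, hxC, rfl⟩ <;>
      rcases hcover y hyX with hy | ⟨y, hy, hyC, rfl⟩
    · rw [h1 x hx, h1 y hy] at hxy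
      exact hf.inj hx hy hxy
    · rw [h1 x hx, h2 y hy] at hxy
      exact absurd (hfF ⟨x, hx, hxy⟩) (hkF y hy hyC).1
    · rw [h1 y hy, h2 x hx] at hxy
      exact absurd (hfF ⟨y, hy, hxy.symm⟩) (hkF x hx hxC).1
    · rw [h2 x hx, h2 y hy] at hxy
      rw [hk.inj hx hy hxy]
  · intro x hxX
    rcases hcover x hxX with hx | ⟨x, hx, hxC, rfl⟩
    · rw [h1 x hx, hf.col x hx]
    · rw [h2 x hx, hk.col x hx, hg.col x (hAU hx)]
  · intro x hxX y hyX
    rcases hcover x hxX with hx | ⟨x, hx, hxC, rfl⟩ <;>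
      rcases hcover y hyX with hy | ⟨y, hy, hyC, rfl⟩
    · rw [h1 x hx, h1 y hy, hf.adj x hx y hy]
    · rw [h1 x hx, h2 y hy, hmix x hx y hy hyC]
    · rw [h1 y hy, h2 x hx]
      exact ⟨fun h => G.symm ((hmix y hy x hx hxC).1 (G.symm h)),
        fun h => G.symm ((hmix y hy x hx hxC).2 (G.symm h))⟩
    · rw [h2 x hx, h2 y hy, hk.adj x hx y hy, hg.adj x (hAU hx) y (hAU hy)]

section Generic

variable (hG : G.Generic w) {κ : Type*} [Finite κ] {E : (κ → V) → (κ → V) → Prop}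
  (hE : Equivalence E) {R : ℕ}
  (hinv : ∀ (x y : κ → V) (f : V → V) (Q : Set V), EmbOn G G f Q →
    G.cl w R (Set.range x ∪ Set.range y) ⊆ Q → (E x y ↔ E (f ∘ x) (f ∘ y)))
include hG hE hinv

/-- If `a₀` and `a₂` are equivalent and their closures are free from each other over `C`, then
`a₀` is equivalent to all tuples that look like `a₀` over `C`. -/
theorem exists_level_of_free {a₀ a₂ : κ → V} {C : Set V} {N T : ℕ}
    (hN : (G.cl w R (Set.range a₀ ∪ Set.range a₂)).ncard ≤ N) (hT : 2 * N + 1 ≤ T)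
    (h1 : E a₀ a₂) (h2 : ∀ x ∈ G.cl w T (Set.range a₀), x ∈ G.cl w T (Set.range a₂) → x ∈ C)
    (h3 : ∀ x ∈ C, ∀ t ≤ T, x ∈ G.cl w t (Set.range a₀) ↔ x ∈ G.cl w t (Set.range a₂))
    (h4 : ∀ x ∈ G.cl w T (Set.range a₀), x ∉ C → ∀ y ∈ G.cl w T (Set.range a₂), y ∉ C →
      ¬ G.adj x y) :
    ∃ s, ∀ f, EmbOn G G f (G.cl w s (Set.range a₀)) →
      (∀ x ∈ G.cl w s (Set.range a₀), x ∈ C → f x = x) → E a₀ (f ∘ a₀) := by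
  classical
  have hfin : ∀ r, ∀ A : Set V, A.Finite → (G.cl w r A).Finite := fun r A => finite_cl hG r
  have hr0 : (Set.range a₀).Finite := Set.finite_range a₀
  have hr2 : (Set.range a₂).Finite := Set.finite_range a₂
  -- One stage at which both closures are closed in `U₀`. Since `s ≤ 2 * N`, the bound on `T` leaves
  -- room for stage `s + 1`.
  obtain ⟨s, hs, hs0, hs2⟩ := exists_stationary₂
    (cl_mono_right (G := G) (w := w) (Set.range a₀)) (cl_mono_right (G := G) (w := w) (Set.range a₂))
    (hfin R _ (hr0.union hr2)) hN
  set U₀ := G.cl w R (Set.range a₀ ∪ Set.range a₂) with hU₀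
  set A := G.cl w s (Set.range a₀) with hA
  set D := G.cl w s (Set.range a₂) with hD
  have hA' : A ⊆ G.cl w (s + 1) (Set.range a₀) := cl_mono_right _ (Nat.le_succ s)
  have hD' : D ⊆ G.cl w (s + 1) (Set.range a₂) := cl_mono_right _ (Nat.le_succ s)
  have hAT : G.cl w (s + 1) (Set.range a₀) ⊆ G.cl w T (Set.range a₀) := cl_mono_right _ (by omega)
  have hDT : G.cl w (s + 1) (Set.range a₂) ⊆ G.cl w T (Set.range a₂) := cl_mono_right _ (by omega)
  have mC : ∀ x ∈ G.cl w (s + 1) (Set.range a₀), x ∈ G.cl w (s + 1) (Set.range a₂) → x ∈ C :=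
    fun x hx hx' => h2 x (hAT hx) (hDT hx')
  have hCs : ∀ x ∈ C, (x ∈ A ↔ x ∈ D) := fun x hx => h3 x hx s (by omega)
  have hCD : ∀ x ∈ A, (x ∈ C ↔ x ∈ D) := fun x hx =>
    ⟨fun h => (hCs x h).1 hx, fun h => mC x (hA' hx) (hD' h)⟩
  let U := U₀ ∪ A ∪ D
  have hUfin : U.Finite := ((hfin _ _ (hr0.union hr2)).union (hfin _ _ hr0)).union (hfin _ _ hr2)
  have hAU : A ⊆ U := fun x hx => Or.inl (Or.inr hx)
  have hDU : D ⊆ U := fun x hx => Or.inr hx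
  have hU₀U : U₀ ⊆ U := fun x hx => Or.inl (Or.inl hx)
  have hrA : Set.range a₀ ⊆ A := subset_cl _ _
  have hrD : Set.range a₂ ⊆ D := subset_cl _ _
  have hclA : ∀ x ∈ U, G.Det w A x → x ∈ A := by
    intro x hx hdet
    have hx1 := det_cl hdet
    rcases hx with (hx | hx) | hx
    · exact hs0 ⟨hx, hx1⟩
    · exact hx
    · exact (hCs x (mC x hx1 (hD' hx))).2 hx
  have hclD : ∀ x ∈ U, G.Det w D x → x ∈ D := by
    intro x hx hdet
    have hx1 := det_cl hdet
    rcases hx with (hx | hx) | hx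
    · exact hs2 ⟨hx, hx1⟩
    · exact (hCs x (mC x (hA' hx) hx1)).1 hx
    · exact hx
  -- The tuple `g ∘ a₀` is a third copy, free over the closure `D` of `a₂`.
  obtain ⟨g, hgD, hg, hgU⟩ := free_extension hG hUfin hclD (EmbOn.id G D) hUfin
    (by rwa [Set.image_id])
  replace hgD : ∀ x ∈ D, g x = x := hgD
  rw [Set.image_id] at hgU
  have hga2 : g ∘ a₂ = a₂ := funext fun i => hgD _ (hrD ⟨i, rfl⟩)
  have hE23 : E a₂ (g ∘ a₀) := by
    have := (hinv a₀ a₂ g U hg hU₀U).1 h1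
    rw [hga2] at this
    exact hE.symm this
  -- Outside `D`, a vertex of `U` has its relevant neighbours in `A`, and a moved vertex `g u` has
  -- them in `g '' A`, so closedness of `A` in `U` suffices. For a vertex of `D` off `C`, edges to
  -- `g '' A` off `C` would come from edges excluded by `h4`.
  have hclX : ∀ x ∈ U ∪ g '' U, G.Det w (A ∪ g '' A) x → x ∈ A ∪ g '' A := by
    have hcase : ∀ x ∈ U, G.Det w (A ∪ g '' A) x → x ∈ A ∪ g '' A := by
      intro x hx hdet
      refine Or.inl ?_
      by_cases hxD : x ∈ D
      · by_contra hxA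
        have hxC : x ∉ C := fun h => hxA ((hCs x h).2 hxD)
        refine hxC (mC x (det_cl (hdet.of_adj ?_)) (hD' hxD))
        rintro y (hy | ⟨z, hz, rfl⟩) hadj
        · exact hy
        · by_cases hzC : z ∈ C
          · rwa [hgD z ((hCD z hz).1 hzC)]
          · rw [← hgD x hxD, hg.adj x hx z (hAU hz)] at hadj
            exact absurd (G.symm hadj) (h4 z (hAT (hA' hz)) hzC x (hDT (hD' hxD)) hxC)
      · refine hclA x hx (hdet.of_adj ?_)
        rintro y (hy | ⟨z, hz, rfl⟩) hadj
        · exact hy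
        · by_cases hzD : z ∈ D
          · rwa [hgD z hzD]
          · exact absurd ((hgU z (hAU hz) hzD).2 x hx (G.symm hadj)) hxD
    rintro x (hx | ⟨u, hu, rfl⟩) hdet
    · exact hcase x hx hdet
    · by_cases huD : u ∈ D
      · rw [hgD u huD] at hdet ⊢
        exact hcase u hu hdet
      · refine Or.inr ⟨u, hclA u hu (Det.of_image (hdet.of_adj ?_) hg hAU hu), rfl⟩
        rintro y (hy | hy) hadj
        · exact ⟨y, hy, hgD y ((hgU u hu huD).2 y (hAU hy) hadj)⟩
        · exact hy
  refine ⟨s, fun f hf hfC => ?_⟩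
  have hAfin : A.Finite := hfin _ _ hr0
  -- A copy of `A` over `C` that is free from both `A` and `f '' A`.
  obtain ⟨k, hkC, hk, hkF⟩ := free_extension hG (D := A ∩ C) (F := A ∪ f '' A) hAfin
    (fun x hx hdet => ⟨hx, mC x (hA' hx)
      (det_cl (hdet.mono fun y hy => (hCD y hy.1).1 hy.2))⟩)
    (EmbOn.id G _) (hAfin.union (hAfin.image f))
    (by rw [Set.image_id]; exact fun x hx => Or.inl hx.1)
  rw [Set.image_id] at hkF
  -- Gluing `f'` on `A` with `k` on the copy `g '' A` gives a map that extends to some `l` defined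
  -- at `a₂`, so `f' ∘ a₀ ~ l ∘ a₂ ~ k ∘ a₀`. The cases `id` and `f` link `a₀` to `f ∘ a₀` through
  -- `k ∘ a₀`.
  have key : ∀ f' : V → V, EmbOn G G f' A → (∀ x ∈ A, x ∈ C → f' x = x) →
      f' '' A ⊆ A ∪ f '' A → E (f' ∘ a₀) (k ∘ a₀) := by
    intro f' hf' hfC' hfF'
    obtain ⟨h, hh, hhf, hhk⟩ := EmbOn.glue hAU hg hgD hgU hCD hf' hfC' hfF' hk
      (fun x hx hxC => hkC ⟨hx, hxC⟩) (fun x hx hxC => hkF x hx fun h => hxC h.2)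
    obtain ⟨l, hlh, hl, -⟩ := free_extension hG (hUfin.union (hUfin.image g)) hclX hh
      ((hAfin.union (hAfin.image g)).image h) subset_rfl
    have e0 : l ∘ a₀ = f' ∘ a₀ := funext fun i => by
      have := hrA ⟨i, rfl⟩
      exact (hlh (Or.inl this)).trans (hhf _ this)
    have e3 : l ∘ (g ∘ a₀) = k ∘ a₀ := funext fun i => by
      have := hrA ⟨i, rfl⟩
      exact (hlh (Or.inr ⟨_, this, rfl⟩)).trans (hhk _ this)
    have t1 := (hinv a₀ a₂ l _ (hl.mono Set.subset_union_left) hU₀U).1 h1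
    have t2 := (hinv a₂ (g ∘ a₀) l _ (hl.mono Set.subset_union_right) (by
      have : Set.range a₂ ∪ Set.range (g ∘ a₀) = g '' (Set.range a₀ ∪ Set.range a₂) := by
        rw [Set.image_union, ← Set.range_comp, ← Set.range_comp, hga2, Set.union_comm]
      rw [this, ← image_cl hG R hg hU₀U]
      exact Set.image_mono hU₀U)).1 hE23
    rw [e0] at t1
    rw [e3] at t2
    exact hE.trans t1 t2
  have t1 := key id (EmbOn.id G A) (fun _ _ _ => rfl) (by rw [Set.image_id]; exact Set.subset_union_left)
  have t2 := key f hf hfC Set.subset_union_right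
  exact hE.trans t1 (hE.symm t2)

/-- There is a level `S`, depending only on `R` and the length of the tuples, such that if `a₀` is
equivalent to a copy of itself whose `S`-closure meets that of `a₀` in fixed points in `C` only,
then `a₀` is equivalent to all tuples that look like `a₀` over `C`. -/
theorem exists_level : ∃ S, ∀ (a₀ : κ → V) (C : Set V) (f : V → V),
    EmbOn G G f (G.cl w S (Set.range a₀)) → E a₀ (f ∘ a₀) →
    (∀ x ∈ G.cl w S (Set.range a₀), x ∈ C → f x = x) →
    (∀ x ∈ G.cl w S (Set.range a₀), f x ∈ G.cl w S (Set.range a₀) → f x ∈ C) →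
    ∃ s, ∀ f, EmbOn G G f (G.cl w s (Set.range a₀)) →
      (∀ x ∈ G.cl w s (Set.range a₀), x ∈ C → f x = x) → E a₀ (f ∘ a₀) := by
  classical
  obtain ⟨N, hN⟩ := exists_card_cl_le hG R (2 * Nat.card κ)
  -- The part `2 * N + 1` is required by `exists_level_of_free`; adding `R` ensures that `B` below
  -- contains the closure on which `E a₀ a₁` depends.
  set T := 2 * N + 1 + R with hT
  obtain ⟨N₁, hN₁⟩ := exists_card_cl_le hG T (2 * Nat.card κ)
  have hcard : ∀ a b : κ → V, (Set.range a ∪ Set.range b).ncard ≤ 2 * Nat.card κ := by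
    intro a b
    have := Set.ncard_union_le (Set.range a) (Set.range b)
    have := ncard_range_le a
    have := ncard_range_le b
    omega
  -- This exceeds every stage `s ≤ T + N₁` that `exists_stationary` may return.
  refine ⟨T + N₁ + 1, fun a₀ C f hf hEf hfC hfC' => ?_⟩
  set S := T + N₁ + 1 with hS
  set a₁ := f ∘ a₀ with ha₁
  have hr0 : (Set.range a₀).Finite := Set.finite_range a₀
  have hr1 : (Set.range a₁).Finite := Set.finite_range a₁
  have hr01 := hr0.union hr1
  have hcl1 : ∀ t ≤ S, G.cl w t (Set.range a₁) = f '' G.cl w t (Set.range a₀) := by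
    intro t ht
    rw [ha₁, Set.range_comp, image_cl hG t hf (cl_mono_right _ ht)]
  set B := G.cl w T (Set.range a₀ ∪ Set.range a₁) with hB
  have hBfin := hN₁ _ hr01 (hcard a₀ a₁)
  obtain ⟨s, hTs, hsN, hs⟩ := exists_stationary
    (cl_mono_right (G := G) (w := w) (Set.range a₁)) hBfin.1 hBfin.2 T
  set D := G.cl w s (Set.range a₁) with hD
  have hBDfin : (B ∪ D).Finite := hBfin.1.union (finite_cl hG s hr1)
  -- The closures of `a₀` and `a₁` may still be joined by edges off `C`. Copying `a₀` freely over
  -- `D` avoids this, and `a₀ ~ a₁ ~ g ∘ a₀` since `g` fixes `a₁`.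
  obtain ⟨g, hgD, hg, hgF⟩ := free_extension hG (D := D) (B := B ∪ D) (F := B ∪ D) hBDfin
    (fun x hx hdet => by
      rcases hx with hx | hx
      · exact hs ⟨hx, det_cl hdet⟩
      · exact hx) (EmbOn.id G D) hBDfin (by rw [Set.image_id]; exact Set.subset_union_right)
  replace hgD : ∀ x ∈ D, g x = x := hgD
  rw [Set.image_id] at hgF
  have hcB : ∀ t ≤ T, G.cl w t (Set.range a₀) ⊆ B ∪ D := fun t ht =>
    ((cl_mono t Set.subset_union_left).trans (cl_mono_right _ ht)).trans Set.subset_union_left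
  have hcl2 : ∀ t ≤ T, G.cl w t (Set.range (g ∘ a₀)) = g '' G.cl w t (Set.range a₀) := by
    intro t ht
    rw [Set.range_comp, image_cl hG t hg (hcB t ht)]
  have hTS : G.cl w T (Set.range a₀) ⊆ G.cl w S (Set.range a₀) := cl_mono_right _ (by omega)
  have hDC : ∀ x ∈ G.cl w T (Set.range a₀), x ∈ D → x ∈ C := by
    intro x hx hxD
    have : x ∈ f '' G.cl w S (Set.range a₀) := by
      rw [← hcl1 S le_rfl]
      exact cl_mono_right (G := G) (w := w) (Set.range a₁) (by omega : s ≤ S) hxD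
    obtain ⟨z, hz, rfl⟩ := this
    exact hfC' z hz (hTS hx)
  have hCD : ∀ x ∈ G.cl w T (Set.range a₀), x ∈ C → x ∈ D := by
    intro x hx hxC
    have : x ∈ G.cl w T (Set.range a₁) := by
      rw [hcl1 T (by omega)]
      exact ⟨x, hx, hfC x (hTS hx) hxC⟩
    exact cl_mono_right (G := G) (w := w) (Set.range a₁) hTs this
  have hga1 : g ∘ a₁ = a₁ := funext fun i => hgD _ (subset_cl _ _ ⟨i, rfl⟩)
  have hE02 : E a₀ (g ∘ a₀) := by
    have := (hinv a₀ a₁ g _ hg ((cl_mono_right (G := G) (w := w) _ (by omega : R ≤ T)).trans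
      Set.subset_union_left)).1 hEf
    rw [hga1] at this
    exact hE.trans hEf (hE.symm this)
  -- The set `C` is cut down to the closure of `a₀`: its other elements might lie in the closure of
  -- `g ∘ a₀` alone.
  obtain ⟨s', hs'⟩ := exists_level_of_free hG hE hinv (a₀ := a₀) (a₂ := g ∘ a₀)
    (C := C ∩ G.cl w T (Set.range a₀)) (N := N) (T := T)
    (hN _ (hr0.union (Set.finite_range _)) (hcard _ _)).2 (by omega) hE02
    (by
      intro x hx hx2
      rw [hcl2 T le_rfl] at hx2
      obtain ⟨z, hz, rfl⟩ := hx2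
      refine ⟨?_, hx⟩
      by_cases hzD : z ∈ D
      · rw [hgD z hzD] at hx ⊢
        exact hDC z hx hzD
      · exact absurd (hcB T le_rfl hx) (hgF z (hcB T le_rfl hz) hzD).1)
    (by
      intro x hx t ht
      rw [hcl2 t ht]
      constructor
      · exact fun hxt => ⟨x, hxt, hgD x (hCD x hx.2 hx.1)⟩
      · rintro ⟨z, hz, rfl⟩
        by_cases hzD : z ∈ D
        · rwa [hgD z hzD]
        · exact absurd (hcB T le_rfl hx.2) (hgF z (hcB t ht hz) hzD).1)
    (by
      intro x hx hxC y hy hyC hadj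
      rw [hcl2 T le_rfl] at hy
      obtain ⟨z, hz, rfl⟩ := hy
      have hzD : z ∉ D := fun h => hyC (by
        rw [hgD z h]
        exact ⟨hDC z hz h, hz⟩)
      exact hxC ⟨hDC x hx ((hgF z (hcB T le_rfl hz) hzD).2 x (hcB T le_rfl hx) (G.symm hadj)), hx⟩)
  exact ⟨s', fun f' hf' hC' => hs' f' hf' fun x hx hxC => hC' x hx hxC.1⟩

end Generic

end IncGraph

end Incidence

/-! ## Models of `T_{m,n}` as bipartite graphs -/

namespace Incidence

section Realize

variable {N : Type*} [lang.Structure N] {α ι κ : Type} {v : α → N}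

/-- `x` is a point. -/
def Pt (x : N) : Prop := Structure.RelMap (L := lang) Symbol.point ![x]

/-- `x` is a line. -/
def Ln (x : N) : Prop := Structure.RelMap (L := lang) Symbol.line ![x]

/-- `x` is incident to `y`. -/
def Inc (x y : N) : Prop := Structure.RelMap (L := lang) Symbol.inc ![x, y]

theorem relMap_point {x : Fin 1 → N} :
    Structure.RelMap (L := lang) Symbol.point x ↔ Pt (x 0) := by
  rw [Pt]
  exact iff_of_eq (congrArg _ (funext fun i => by fin_cases i; rfl))

theorem relMap_line {x : Fin 1 → N} :
    Structure.RelMap (L := lang) Symbol.line x ↔ Ln (x 0) := by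
  rw [Ln]
  exact iff_of_eq (congrArg _ (funext fun i => by fin_cases i; rfl))

theorem relMap_inc {x : Fin 2 → N} :
    Structure.RelMap (L := lang) Symbol.inc x ↔ Inc (x 0) (x 1) := by
  rw [Inc]
  exact iff_of_eq (congrArg _ (funext fun i => by fin_cases i <;> rfl))

theorem realize_isPoint {x : α} : (isPoint x).Realize v ↔ Pt (v x) :=
  Formula.realize_rel₁ (L := lang)

theorem realize_isLine {x : α} : (isLine x).Realize v ↔ Ln (v x) :=
  Formula.realize_rel₁ (L := lang)

theorem realize_incident {x y : α} : (incident x y).Realize v ↔ Inc (v x) (v y) :=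
  Formula.realize_rel₂ (L := lang)

theorem realize_eqF {x y : α} : (eqF x y).Realize v ↔ v x = v y := by
  simp [eqF]

theorem realize_distinct [Finite ι] {x : ι → α} :
    (distinct x).Realize v ↔ Function.Injective (v ∘ x) := by
  simp only [distinct, Formula.realize_iInf, Formula.realize_not, realize_eqF, Subtype.forall,
    Prod.forall]
  exact ⟨fun h i j hij => by_contra fun hne => h i j hne hij, fun h i j hne hij => hne (h hij)⟩

theorem realize_distinctPoints [Finite ι] {x : ι → α} :
    (distinctPoints x).Realize v ↔ Function.Injective (v ∘ x) ∧ ∀ i, Pt (v (x i)) := by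
  simp only [distinctPoints, Formula.realize_inf, Formula.realize_iInf, realize_distinct,
    realize_isPoint]

theorem realize_distinctLines [Finite ι] {x : ι → α} :
    (distinctLines x).Realize v ↔ Function.Injective (v ∘ x) ∧ ∀ i, Ln (v (x i)) := by
  simp only [distinctLines, Formula.realize_inf, Formula.realize_iInf, realize_distinct,
    realize_isLine]

theorem realize_allIncident [Finite ι] [Finite κ] {x : ι → α} {y : κ → α} :
    (allIncident x y).Realize v ↔ ∀ i j, Inc (v (x i)) (v (y j)) := by
  simp only [allIncident, Formula.realize_iInf, realize_incident, Prod.forall]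

theorem realize_literal {A : Type} [lang.Structure A] (e : ι → A) (φ : lang.Formula ι)
    {v : ι → N} : (literal e φ).Realize v ↔ (φ.Realize v ↔ φ.Realize e) := by
  unfold literal
  split_ifs with h <;> simp [h]

theorem realize_diagram {A : Type} [lang.Structure A] [Finite ι] (e : ι → A) {v : ι → N} :
    (diagram e).Realize v ↔ (∀ i j, v i = v j ↔ e i = e j) ∧ (∀ i, Pt (v i) ↔ Pt (e i)) ∧
      (∀ i, Ln (v i) ↔ Ln (e i)) ∧ ∀ i j, Inc (v i) (v j) ↔ Inc (e i) (e j) := by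
  simp only [diagram, Formula.realize_inf, Formula.realize_iInf, realize_literal, realize_isPoint,
    realize_isLine, realize_incident, realize_eqF, Prod.forall, and_assoc]

end Realize

open Classical in
/-- The two-coloured graph of an incidence structure. -/
noncomputable def graph (N : Type*) [lang.Structure N] : IncGraph N where
  col x := decide (Pt x)
  -- The guards make the colouring proper even if `N` is not an incidence structure.
  adj x y := (Inc x y ∧ Pt x ∧ ¬ Pt y) ∨ (Inc y x ∧ Pt y ∧ ¬ Pt x)
  symm h := h.symm
  col_ne h := by
    rcases h with ⟨-, h1, h2⟩ | ⟨-, h1, h2⟩ <;> simp [h1, h2]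

/-- The numbers of neighbours that determine a vertex: `n` lines for a point and `m` points for a
line. -/
def weight (m n : ℕ) (c : Bool) : ℕ := if c then n else m

/-- `N` is an incidence structure. -/
structure IsInc (N : Type*) [lang.Structure N] : Prop where
  line_iff : ∀ x : N, Ln x ↔ ¬ Pt x
  of_inc : ∀ x y : N, Inc x y → Pt x ∧ Ln y

section IsInc

variable {N : Type*} [lang.Structure N]

theorem graph_col_eq_true {x : N} : (graph N).col x = true ↔ Pt x := by
  simp [graph]

theorem graph_col_eq_false {x : N} : (graph N).col x = false ↔ ¬ Pt x := by
  simp [graph]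

theorem graph_col_eq {N' : Type*} [lang.Structure N'] {x : N} {y : N'} :
    (graph N).col x = (graph N').col y ↔ (Pt x ↔ Pt y) := by
  simp [graph]

theorem IsInc.not_pt (hN : IsInc N) {x y : N} (h : Inc x y) : ¬ Pt y :=
  (hN.line_iff y).1 (hN.of_inc x y h).2

theorem IsInc.adj_iff (hN : IsInc N) {x y : N} : (graph N).adj x y ↔ Inc x y ∨ Inc y x := by
  constructor
  · rintro (h | h)
    · exact Or.inl h.1
    · exact Or.inr h.1
  · rintro (h | h)
    · exact Or.inl ⟨h, (hN.of_inc _ _ h).1, hN.not_pt h⟩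
    · exact Or.inr ⟨h, (hN.of_inc _ _ h).1, hN.not_pt h⟩

theorem IsInc.inc_iff (hN : IsInc N) {x y : N} : Inc x y ↔ (graph N).adj x y ∧ Pt x := by
  rw [hN.adj_iff]
  constructor
  · exact fun h => ⟨Or.inl h, (hN.of_inc _ _ h).1⟩
  · rintro ⟨h | h, hx⟩
    · exact h
    · exact absurd hx (hN.not_pt h)

theorem model_incidenceStructures : N ⊨ incidenceStructures ↔ IsInc N := by
  simp only [incidenceStructures, Theory.model_insert_iff, Theory.model_singleton_iff,
    Sentence.Realize, Formula.realize_iAlls, Formula.realize_sup, Formula.realize_inf,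
    Formula.realize_imp, Formula.realize_not, realize_isPoint, realize_isLine, realize_incident,
    Sum.elim_inr]
  constructor
  · rintro ⟨h1, h2, h3⟩
    refine ⟨fun x => ?_, fun x y h => h3 ![x, y] h⟩
    have := h1 ![x]
    have := h2 ![x]
    simp at *
    tauto
  · rintro ⟨h1, h2⟩
    refine ⟨fun x => ?_, fun x => ?_, fun x => h2 _ _⟩
    · rw [h1]
      tauto
    · rw [h1]
      tauto

variable {m n : ℕ}

theorem IsInc.model_free (hN : IsInc N) :
    N ⊨ free m n ↔ (graph N).Free (weight m n) := by
  simp only [free, Sentence.Realize, Formula.realize_iAlls, Formula.realize_inf,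
    Formula.realize_not, realize_distinctPoints, realize_distinctLines, realize_allIncident,
    Sum.elim_inr]
  constructor
  · intro h
    have key : ∀ A B : Finset N, (∀ x ∈ A, Pt x) → (∀ y ∈ B, ¬ Pt y) →
        (∀ x ∈ A, ∀ y ∈ B, (graph N).adj x y) → m ≤ A.card → n ≤ B.card → False := by
      intro A B hA hB hAB hm hn
      let a : Fin m → N := fun i => A.equivFin.symm (Fin.castLE hm i)
      let b : Fin n → N := fun i => B.equivFin.symm (Fin.castLE hn i)
      have ha : a.Injective := Subtype.val_injective.comp
        (A.equivFin.symm.injective.comp (Fin.castLE_injective hm))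
      have hb : b.Injective := Subtype.val_injective.comp
        (B.equivFin.symm.injective.comp (Fin.castLE_injective hn))
      have haA : ∀ i, a i ∈ A := fun i => (A.equivFin.symm (Fin.castLE hm i)).2
      have hbB : ∀ i, b i ∈ B := fun i => (B.equivFin.symm (Fin.castLE hn i)).2
      exact h (Sum.elim a b) ⟨⟨⟨ha, fun i => hA _ (haA i)⟩, hb,
        fun i => (hN.line_iff _).2 (hB _ (hbB i))⟩,
        fun i j => hN.inc_iff.2 ⟨hAB _ (haA i) _ (hbB j), hA _ (haA i)⟩⟩
    intro c A B hA hB hAB hAc hBc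
    cases c
    · exact key B A (fun x hx => graph_col_eq_true.1 (hB x hx))
        (fun x hx => graph_col_eq_false.1 (hA x hx))
        (fun x hx y hy => (graph N).symm (hAB y hy x hx)) hBc hAc
    · exact key A B (fun x hx => graph_col_eq_true.1 (hA x hx))
        (fun x hx => graph_col_eq_false.1 (hB x hx)) hAB hAc hBc
  · classical
    rintro h x ⟨⟨⟨h1, h2⟩, h3, h4⟩, h5⟩
    refine h true (Finset.univ.image fun i => x (.inl i)) (Finset.univ.image fun j => x (.inr j))
      ?_ ?_ ?_ ?_ ?_
    · simp only [Finset.forall_mem_image]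
      exact fun i _ => graph_col_eq_true.2 (h2 i)
    · simp only [Finset.forall_mem_image]
      exact fun i _ => graph_col_eq_false.2 ((hN.line_iff _).1 (h4 i))
    · simp only [Finset.forall_mem_image]
      exact fun i _ j _ => hN.adj_iff.2 (Or.inl (h5 i j))
    · rw [Finset.card_image_of_injective _ (f := fun i => x (.inl i)) h1]
      simp [weight]
    · rw [Finset.card_image_of_injective _ (f := fun j => x (.inr j)) h3]
      simp [weight]

theorem model_Tp : N ⊨ Tp m n ↔ IsInc N ∧ (graph N).Free (weight m n) := by
  rw [Tp, Theory.model_union_iff, model_incidenceStructures, Theory.model_singleton_iff]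
  exact and_congr_right fun h => h.model_free

theorem full_graph (hN : IsInc N) (h1 : N ⊨ enoughLines m n) (h2 : N ⊨ enoughPoints m n) :
    (graph N).Full (weight m n) := by
  classical
  simp only [enoughLines, enoughPoints, Sentence.Realize, Formula.realize_iAlls,
    Formula.realize_inf, Formula.realize_imp, Formula.realize_iExs, realize_distinctPoints,
    realize_distinctLines, realize_allIncident, Sum.elim_inr, Sum.elim_inl] at h1 h2
  have hcard : ∀ {k : ℕ} {B : Finset N}, B.card = k → ∃ b : Fin k → N, b.Injective ∧
      (∀ i, b i ∈ B) ∧ ∀ y ∈ B, ∃ i, b i = y := by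
    rintro k B rfl
    exact ⟨fun i => B.equivFin.symm i, Subtype.val_injective.comp B.equivFin.symm.injective,
      fun i => (B.equivFin.symm i).2, fun y hy => ⟨B.equivFin ⟨y, hy⟩, by simp⟩⟩
  intro c B hB hBc
  obtain ⟨b, hb, hbB, hBb⟩ := hcard hBc
  cases c
  · obtain ⟨a, ⟨ha, hal⟩, hab⟩ := h1 b ⟨hb, fun i => graph_col_eq_true.1 (hB _ (hbB i))⟩
    refine ⟨Finset.univ.image a, ?_, ?_⟩
    · simp only [Finset.forall_mem_image]
      refine fun i _ => ⟨graph_col_eq_false.2 ((hN.line_iff _).1 (hal i)), fun y hy => ?_⟩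
      obtain ⟨j, rfl⟩ := hBb y hy
      exact hN.adj_iff.2 (Or.inr (hab j i))
    · rw [Finset.card_image_of_injective _ (f := a) ha]
      simp [weight]
      omega
  · obtain ⟨a, ⟨ha, hal⟩, hab⟩ := h2 b
      ⟨hb, fun i => (hN.line_iff _).2 (graph_col_eq_false.1 (hB _ (hbB i)))⟩
    refine ⟨Finset.univ.image a, ?_, ?_⟩
    · simp only [Finset.forall_mem_image]
      refine fun i _ => ⟨graph_col_eq_true.2 (hal i), fun y hy => ?_⟩
      obtain ⟨j, rfl⟩ := hBb y hy
      exact hN.adj_iff.2 (Or.inl (hab i j))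
    · rw [Finset.card_image_of_injective _ (f := a) ha]
      simp [weight]
      omega

/-- The incidence structure of a two-coloured graph. -/
abbrev structureOf {V : Type*} (H : IncGraph V) : lang.Structure V where
  funMap f := f.elim
  RelMap {_} R :=
    match R with
    | .point => fun x => H.col (x 0) = true
    | .line => fun x => H.col (x 0) = false
    | .inc => fun x => H.adj (x 0) (x 1) ∧ H.col (x 0) = true

theorem isInc_structureOf {V : Type*} (H : IncGraph V) :
    letI := structureOf H
    IsInc V := by
  let := structureOf H
  refine ⟨fun x => ?_, fun x y h => ?_⟩
  · exact (Bool.not_eq_true _).symm.to_iff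
  · refine ⟨h.2, ?_⟩
    have h1 : H.adj x y := h.1
    have h2 : H.col x = true := h.2
    change H.col y = false
    rw [IncGraph.col_eq_not h1, h2]
    rfl

theorem graph_structureOf {V : Type*} (H : IncGraph V) :
    letI := structureOf H
    (graph V).col = H.col ∧ (graph V).adj = H.adj := by
  let := structureOf H
  have hcol : (graph V).col = H.col := by
    funext x
    rw [Bool.eq_iff_iff, graph_col_eq_true]
    exact Iff.rfl
  refine ⟨hcol, ?_⟩
  funext x y
  refine propext ?_
  rw [(isInc_structureOf H).adj_iff]
  constructor
  · rintro (h | h)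
    · exact h.1
    · exact H.symm h.1
  · intro h
    cases hx : H.col x
    · exact Or.inr ⟨H.symm h, by
        change H.col y = true
        rw [IncGraph.col_eq_not h, hx]
        rfl⟩
    · exact Or.inl ⟨h, hx⟩

/-- The graph `H` on the variables is turned into an incidence structure; its diagram is safe and
names the axiom to apply. -/
theorem extends_graph (hN : IsInc N)
    (h : ∀ D : SafeDiagram m n, N ⊨ D.extension) :
    (graph N).Extends (weight m n) := by
  intro p q H hH hsafe a ha hacol haadj
  let str := structureOf H
  have hI := isInc_structureOf H
  obtain ⟨hgc, hga⟩ := graph_structureOf H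
  have hgH : graph (Fin p ⊕ Fin q) = H := by
    cases H
    cases hg : graph (Fin p ⊕ Fin q)
    simp_all
  have hle : ∀ (j : Fin q) (S : Set (Fin p)), (∀ i ∈ S, H.adj (.inr j) (.inl i)) →
      S.ncard ≤ weight m n (H.col (.inr j)) - 1 := by
    intro j S hS
    classical
    rw [Set.ncard_eq_toFinset_card' S]
    have := hsafe j S.toFinset (by simpa using hS)
    omega
  let D : SafeDiagram m n := {
    p := p
    q := q
    str := str
    model := model_Tp.2 ⟨hI, hgH ▸ hH⟩
    point_le := by
      intro j hj
      have := hle j {i | (isLine (Sum.inl i : Fin p ⊕ Fin q)).Realize id ∧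
        (incident (Sum.inr j) (Sum.inl i : Fin p ⊕ Fin q)).Realize id} ?_
      · have hc : H.col (.inr j) = true := realize_isPoint.1 hj
        simpa [weight, hc] using this
      · rintro i ⟨-, h⟩
        rw [← hga]
        exact hI.adj_iff.2 (Or.inl (realize_incident.1 h))
    line_le := by
      intro j hj
      have := hle j {i | (isPoint (Sum.inl i : Fin p ⊕ Fin q)).Realize id ∧
        (incident (Sum.inl i) (Sum.inr j : Fin p ⊕ Fin q)).Realize id} ?_
      · have hc : H.col (.inr j) = false := realize_isLine.1 hj
        simpa [weight, hc] using this
      · rintro i ⟨-, h⟩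
        rw [← hga]
        exact hI.adj_iff.2 (Or.inr (realize_incident.1 h)) }
  have hD := h D
  have hpt : ∀ (x : N) (y : Fin p ⊕ Fin q), (Pt x ↔ Pt y) ↔ (graph N).col x = H.col y := by
    intro x y
    rw [← hgH, graph_col_eq]
  have hpta : ∀ i, Pt (a i) ↔ Pt (.inl i : Fin p ⊕ Fin q) := fun i => (hpt _ _).2 (hacol i)
  simp only [SafeDiagram.extension, Sentence.Realize, Formula.realize_iAlls, Formula.realize_imp,
    Formula.realize_iExs, Formula.realize_relabel, SafeDiagram.restricted, SafeDiagram.full,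
    realize_diagram] at hD
  have hinc : ∀ i j, Inc (a i) (a j) ↔ Inc (.inl i : Fin p ⊕ Fin q) (.inl j) := by
    intro i j
    refine hN.inc_iff.trans (Iff.trans ?_ hI.inc_iff.symm)
    rw [hga]
    exact and_congr (haadj i j) (hpta i)
  obtain ⟨b, hb1, hb2, -, hb3⟩ := hD a ⟨fun i j =>
    ⟨fun h => congrArg _ (ha h), fun h => congrArg a (Sum.inl_injective h)⟩, hpta,
    fun i => (hN.line_iff _).trans ((not_congr (hpta i)).trans (hI.line_iff _).symm), hinc⟩
  refine ⟨b, ⟨?_, ?_, ?_⟩⟩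
  · intro x _ y _ hxy
    refine (hb1 x y).1 ?_
    rcases x with i | i <;> rcases y with j | j <;> exact hxy
  · intro x _
    refine (hpt _ _).1 ?_
    have := hb2 x
    rcases x with i | i <;> exact this
  · intro x _ y _
    rw [← hga, hN.adj_iff, hI.adj_iff]
    have h1 := hb3 x y
    have h2 := hb3 y x
    rcases x with i | i <;> rcases y with j | j <;> exact or_congr h1 h2

theorem generic_graph (hm : 1 ≤ m) (hn : 1 ≤ n) [hT : N ⊨ T m n] :
    IsInc N ∧ (graph N).Generic (weight m n) := by
  rw [T, Tc, Theory.model_union_iff, Theory.model_union_iff, model_Tp,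
    Theory.model_insert_iff, Theory.model_singleton_iff] at hT
  obtain ⟨⟨⟨hI, hF⟩, h1, h2⟩, h3⟩ := hT
  refine ⟨hI, ⟨fun c => ?_, hF, full_graph hI h1 h2, ?_⟩⟩
  · cases c <;> assumption
  · exact extends_graph hI fun D => h3.realize_of_mem _ ⟨D, rfl⟩

end IsInc

end Incidence

namespace Incidence

/-! ## Formulas only depend on finite closures -/

section Realize

variable {M : Type*} [lang.Structure M]

theorem realize_comp_term {β : Type} (t : lang.Term β) (f : M → M) (v : β → M) :
    t.realize (f ∘ v) = f (t.realize v) ∧ t.realize v ∈ Set.range v := by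
  cases t with
  | var x => exact ⟨rfl, ⟨x, rfl⟩⟩
  | func g _ => exact g.elim

variable {w : Bool → ℕ}

theorem IncGraph.EmbOn.inc_iff (hI : IsInc M) {f : M → M} {Q : Set M}
    (hf : (graph M).EmbOn (graph M) f Q) {x y : M} (hx : x ∈ Q) (hy : y ∈ Q) :
    Inc (f x) (f y) ↔ Inc x y := by
  rw [hI.inc_iff, hI.inc_iff, hf.adj x hx y hy, graph_col_eq.1 (hf.col x hx)]

/-- Whether a tuple satisfies a given formula is determined by the isomorphism type of a finite
stage of its closure. -/
theorem exists_level_realize (hI : IsInc M) (hG : (graph M).Generic w) {α : Type} [Finite α]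
    {l : ℕ} (φ : lang.BoundedFormula α l) :
    ∃ R, ∀ (v : α → M) (xs : Fin l → M) (f : M → M) (Q : Set M),
      (graph M).EmbOn (graph M) f Q → (graph M).cl w R (Set.range v ∪ Set.range xs) ⊆ Q →
        (φ.Realize v xs ↔ φ.Realize (f ∘ v) (f ∘ xs)) := by
  have hterm : ∀ {l : ℕ} (t : lang.Term (α ⊕ Fin l)) (f : M → M) (v : α → M) (xs : Fin l → M),
      t.realize (Sum.elim (f ∘ v) (f ∘ xs)) = f (t.realize (Sum.elim v xs)) ∧
        t.realize (Sum.elim v xs) ∈ Set.range v ∪ Set.range xs := by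
    intro l t f v xs
    rw [← Sum.comp_elim, ← Set.Sum.elim_range]
    exact realize_comp_term t f _
  induction φ with
  | falsum => exact ⟨0, fun _ _ _ _ _ _ => Iff.rfl⟩
  | equal t₁ t₂ =>
    refine ⟨0, fun v xs f Q hf hQ => ?_⟩
    obtain ⟨e₁, m₁⟩ := hterm t₁ f v xs
    obtain ⟨e₂, m₂⟩ := hterm t₂ f v xs
    change t₁.realize _ = t₂.realize _ ↔ t₁.realize _ = t₂.realize _
    rw [e₁, e₂]
    exact (hf.inj.eq_iff (hQ m₁) (hQ m₂)).symm
  | rel R ts =>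
    refine ⟨0, fun v xs f Q hf hQ => ?_⟩
    have e := fun i => (hterm (ts i) f v xs).1
    have hm := fun i => hQ (hterm (ts i) f v xs).2
    change Structure.RelMap R (fun i => (ts i).realize _) ↔
      Structure.RelMap R (fun i => (ts i).realize _)
    simp only [e]
    cases R with
    | point => exact relMap_point.trans ((graph_col_eq.1 (hf.col _ (hm 0))).symm.trans
        (relMap_point (x := fun i => f ((ts i).realize (Sum.elim v xs)))).symm)
    | line =>
      refine relMap_line.trans (Iff.trans ?_ relMap_line.symm)
      rw [hI.line_iff, hI.line_iff]
      exact not_congr (graph_col_eq.1 (hf.col _ (hm 0))).symm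
    | inc => exact relMap_inc.trans ((hf.inc_iff hI (hm 0) (hm 1)).symm.trans
        (relMap_inc (x := fun i => f ((ts i).realize (Sum.elim v xs)))).symm)
  | imp φ ψ ih₁ ih₂ =>
    obtain ⟨R₁, h₁⟩ := ih₁
    obtain ⟨R₂, h₂⟩ := ih₂
    refine ⟨max R₁ R₂, fun v xs f Q hf hQ => ?_⟩
    exact imp_congr
      (h₁ v xs f Q hf ((IncGraph.cl_mono_right _ (le_max_left _ _)).trans hQ))
      (h₂ v xs f Q hf ((IncGraph.cl_mono_right _ (le_max_right _ _)).trans hQ))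
  | @all l φ ih =>
    obtain ⟨R, hR⟩ := ih
    obtain ⟨N, hN⟩ := IncGraph.exists_card_cl_le hG R (Nat.card α + (l + 1))
    -- Some stage `s ≤ N` of the closure of the parameters is closed in the `R`-closure `B` of the
    -- tuple lengthened by `c`. So `f`, restricted to that stage, extends to `B`, and the image of
    -- `c` is an instance `d`.
    have key : ∀ (v : α → M) (xs : Fin l → M) (f : M → M) (Q : Set M),
        (graph M).EmbOn (graph M) f Q → (graph M).cl w (N + 1) (Set.range v ∪ Set.range xs) ⊆ Q →
        (∀ d, φ.Realize (f ∘ v) (Fin.snoc (f ∘ xs) d)) → ∀ c, φ.Realize v (Fin.snoc xs c) := by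
      intro v xs f Q hf hQ hd c
      set a := Set.range v ∪ Set.range xs with ha
      have hafin : a.Finite := (Set.finite_range v).union (Set.finite_range xs)
      set xs' : Fin (l + 1) → M := Fin.snoc xs c
      obtain ⟨hBfin, hBN⟩ := hN (Set.range v ∪ Set.range xs')
        ((Set.finite_range v).union (Set.finite_range xs'))
        ((Set.ncard_union_le _ _).trans (add_le_add (IncGraph.ncard_range_le v) (by
          simpa using IncGraph.ncard_range_le xs')))
      set B := (graph M).cl w R (Set.range v ∪ Set.range xs')
      obtain ⟨s, -, hsN, hs⟩ := IncGraph.exists_stationary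
        (IncGraph.cl_mono_right (G := graph M) (w := w) a) hBfin hBN 0
      set D := (graph M).cl w s a
      have hDQ : D ⊆ Q := (IncGraph.cl_mono_right _ (by omega)).trans hQ
      have hDfin : D.Finite := IncGraph.finite_cl hG s hafin
      obtain ⟨g, hgD, hg, -⟩ := IncGraph.free_extension hG (D := D) (B := D ∪ B) (F := f '' D)
        (hDfin.union hBfin)
        (fun x hx hdet => by
          rcases hx with hx | hx
          · exact hx
          · exact hs ⟨hx, IncGraph.det_cl hdet⟩)
        (hf.mono hDQ) (hDfin.image f) subset_rfl
      have haD : a ⊆ D := IncGraph.subset_cl _ _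
      have hv : g ∘ v = f ∘ v := funext fun i => hgD (haD (Or.inl ⟨i, rfl⟩))
      have hxs : g ∘ xs = f ∘ xs := funext fun i => hgD (haD (Or.inr ⟨i, rfl⟩))
      rw [hR v xs' g _ hg Set.subset_union_right, hv, Fin.comp_snoc, hxs]
      exact hd _
    refine ⟨N + 1, fun v xs f Q hf hQ => ?_⟩
    simp only [BoundedFormula.realize_all]
    refine ⟨fun h => ?_, key v xs f Q hf hQ⟩
    by_cases hne : Nonempty M
    · obtain ⟨f', hf', hff'⟩ := (hf.mono hQ).exists_inverse
      have hsub : Set.range v ∪ Set.range xs ⊆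
          (graph M).cl w (N + 1) (Set.range v ∪ Set.range xs) := IncGraph.subset_cl _ _
      have hv : f' ∘ (f ∘ v) = v := funext fun i => hff' _ (hsub (Or.inl ⟨i, rfl⟩))
      have hxs : f' ∘ (f ∘ xs) = xs := funext fun i => hff' _ (hsub (Or.inr ⟨i, rfl⟩))
      refine key (f ∘ v) (f ∘ xs) f' _ hf' ?_ (by rwa [hv, hxs])
      rw [Set.range_comp, Set.range_comp, ← Set.image_union, IncGraph.image_cl hG _ hf hQ]
    · exact fun x => absurd ⟨x⟩ hne

end Realize

end Incidence

/-! ## Copies of finite substructures in `M^eq` -/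

namespace Imaginaries

theorem Meq.real_injective {L : FirstOrder.Language.{u, v}} {M : Type w} [L.Structure M] :
    Function.Injective (Meq.real L : M → Meq L M) :=
  Sum.inl_injective

theorem Meq.cls_eq_cls {L : FirstOrder.Language.{u, v}} {M : Type w} [L.Structure M]
    {S : ImagSort L M} {a b : Fin S.arity → M} :
    Meq.cls S a = Meq.cls S b ↔ S.fml.Realize (Sum.elim a b) := by
  constructor
  · intro h
    have h1 := Sum.inr_injective h
    exact Quotient.exact (eq_of_heq (Sigma.mk.inj h1).2)
  · intro h
    have : Quotient.mk S.setoid a = Quotient.mk S.setoid b := Quotient.sound h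
    unfold Meq.cls
    rw [this]

end Imaginaries

namespace Incidence

open Imaginaries

variable {M : Type w} [lang.Structure M]

/-- `z` satisfies the same atomic formulas as `ρ`. -/
def IsCopy {I : Type*} (ρ z : I → M) : Prop :=
  (∀ i j, z i = z j ↔ ρ i = ρ j) ∧ (∀ i, Pt (z i) ↔ Pt (ρ i)) ∧
    ∀ i j, Inc (z i) (z j) ↔ Inc (ρ i) (ρ j)

/-- The colour only records whether a vertex is a point, so `IsCopy` can do without `Ln`. -/
theorem IsCopy.exists_embOn (hI : IsInc M) {A : Set M} {z : A → M}
    (hz : IsCopy (fun i : A => (i : M)) z) :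
    ∃ f, (graph M).EmbOn (graph M) f A ∧ ∀ i : A, f i = z i := by
  classical
  obtain ⟨f, h⟩ : ∃ f : M → M, ∀ i : A, f i = z i :=
    ⟨fun x => if hx : x ∈ A then z ⟨x, hx⟩ else x, fun i => by simp⟩
  refine ⟨f, ⟨?_, ?_, ?_⟩, h⟩
  · intro x hx y hy hxy
    rw [h ⟨x, hx⟩, h ⟨y, hy⟩] at hxy
    exact (hz.1 _ _).1 hxy
  · intro x hx
    rw [h ⟨x, hx⟩, graph_col_eq]
    exact hz.2.1 _
  · intro x hx y hy
    rw [h ⟨x, hx⟩, h ⟨y, hy⟩, hI.adj_iff, hI.adj_iff]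
    exact or_congr (hz.2.2 _ _) (hz.2.2 _ _)

/-- As `I` is finite, this is a finite conjunction of literals prescribed by `ρ`. Variables range
over all of `Meq`, so the home sort has to be imposed on them. -/
theorem defPred_isCopy {I : Type*} [Finite I] (ρ : I → M) (A : Set (Meq lang M)) :
    DefPred (langEq lang M) A fun y : I → Meq lang M =>
      ∃ z : I → M, (∀ i, y i = Meq.real lang (z i)) ∧ IsCopy ρ z := by
  have h1 : DefPred (langEq lang M) A fun y : I → Meq lang M => ∀ i, ∃ a, y i = Meq.real lang a :=
    DefPred.all fun i => DefPred.rel (L := langEq lang M) EqSymbol.home fun _ => i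
  have h2 : DefPred (langEq lang M) A fun y : I → Meq lang M => ∀ i j, y i = y j ↔ ρ i = ρ j :=
    DefPred.all fun i => DefPred.all fun j => (DefPred.eq i j).iff_const _
  have h3 : DefPred (langEq lang M) A fun y : I → Meq lang M => ∀ i,
      (∃ a : Fin 1 → M, (∀ k : Fin 1, y (![i] k) = Meq.real lang (a k)) ∧
        Structure.RelMap (L := lang) Symbol.point a) ↔ Pt (ρ i) :=
    DefPred.all fun i => (DefPred.rel (L := langEq lang M)
      (EqSymbol.rel (L := lang) Symbol.point) ![i]).iff_const _
  have h4 : DefPred (langEq lang M) A fun y : I → Meq lang M => ∀ i j,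
      (∃ a : Fin 2 → M, (∀ k : Fin 2, y (![i, j] k) = Meq.real lang (a k)) ∧
        Structure.RelMap (L := lang) Symbol.inc a) ↔ Inc (ρ i) (ρ j) :=
    DefPred.all fun i => DefPred.all fun j => (DefPred.rel (L := langEq lang M)
      (EqSymbol.rel (L := lang) Symbol.inc) ![i, j]).iff_const _
  refine (h1.and (h2.and (h3.and h4))).congr fun y => ?_
  have hpt : ∀ z : I → M, (∀ i, y i = Meq.real lang (z i)) → ∀ i,
      ((∃ a : Fin 1 → M, (∀ k : Fin 1, y (![i] k) = Meq.real lang (a k)) ∧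
        Structure.RelMap (L := lang) Symbol.point a) ↔ Pt (z i)) := by
    intro z hz i
    constructor
    · rintro ⟨a, ha, hR⟩
      have : z i = a 0 := Meq.real_injective ((hz i).symm.trans (ha 0))
      rw [this]
      exact relMap_point.1 hR
    · exact fun h => ⟨![z i], fun k => by fin_cases k; exact hz i, relMap_point.2 h⟩
  have hinc : ∀ z : I → M, (∀ i, y i = Meq.real lang (z i)) → ∀ i j,
      ((∃ a : Fin 2 → M, (∀ k : Fin 2, y (![i, j] k) = Meq.real lang (a k)) ∧
        Structure.RelMap (L := lang) Symbol.inc a) ↔ Inc (z i) (z j)) := by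
    intro z hz i j
    constructor
    · rintro ⟨a, ha, hR⟩
      have e1 : z i = a 0 := Meq.real_injective ((hz i).symm.trans (ha 0))
      have e2 : z j = a 1 := Meq.real_injective ((hz j).symm.trans (ha 1))
      rw [e1, e2]
      exact relMap_inc.1 hR
    · refine fun h => ⟨![z i, z j], fun k => ?_, relMap_inc.2 h⟩
      fin_cases k
      · exact hz i
      · exact hz j
  constructor
  · rintro ⟨z, hz, hc1, hc2, hc3⟩
    refine ⟨fun i => ⟨z i, hz i⟩, fun i j => ?_, fun i => ?_, fun i j => ?_⟩
    · rw [hz, hz, Meq.real_injective.eq_iff, hc1]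
    · rw [hpt z hz, hc2]
    · rw [hinc z hz, hc3]
  · rintro ⟨hz, hc1, hc2, hc3⟩
    choose z hz using hz
    refine ⟨z, hz, fun i j => ?_, fun i => ?_, fun i j => ?_⟩
    · rw [← hc1, hz, hz, Meq.real_injective.eq_iff]
    · rw [← hpt z hz, hc2]
    · rw [← hinc z hz, hc3]

/-- The relation between copies `y` of `ρ` and the class `u` of a subtuple of `y` is definable. -/
theorem defPred_copy_cls {I : Type*} [Finite I] {α : Type*} (ρ : I → M) (S : ImagSort lang M)
    (t : Fin S.arity → I) (A : Set (Meq lang M)) (g : I → α) (u : α) :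
    DefPred (langEq lang M) A fun x : α → Meq lang M =>
      ∃ z : I → M, (∀ i, x (g i) = Meq.real lang (z i)) ∧ IsCopy ρ z ∧
        x u = Meq.cls S (z ∘ t) := by
  have h1 := (defPred_isCopy ρ A).comp g
  have h2 := DefPred.rel (L := langEq lang M) (A := A) (EqSymbol.proj S)
    (Fin.snoc (α := fun _ => α) (fun k => g (t k)) u)
  refine (h1.and h2).congr fun x => ?_
  have hproj : (Structure.RelMap (L := langEq lang M) (EqSymbol.proj S)
      fun i => x (Fin.snoc (α := fun _ => α) (fun k => g (t k)) u i)) ↔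
      ∃ a : Fin S.arity → M, (∀ k, x (g (t k)) = Meq.real lang (a k)) ∧ x u = Meq.cls S a := by
    change (∃ a : Fin S.arity → M, (∀ i : Fin S.arity, _ = _) ∧ _ = _) ↔ _
    simp only [Fin.snoc_castSucc, Fin.snoc_last]
  rw [hproj]
  constructor
  · rintro ⟨z, hz, hc, hu⟩
    exact ⟨⟨z, hz, hc⟩, z ∘ t, fun k => hz _, hu⟩
  · rintro ⟨⟨z, hz, hc⟩, a, ha, hu⟩
    refine ⟨z, hz, hc, ?_⟩
    rw [hu]
    congr 1
    exact funext fun k => Meq.real_injective ((ha k).symm.trans (hz _))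

theorem exists_level_imagSort (hI : IsInc M) {w : Bool → ℕ} (hG : (graph M).Generic w)
    (S : ImagSort lang M) : ∃ R, ∀ (x y : Fin S.arity → M) (f : M → M) (Q : Set M),
      (graph M).EmbOn (graph M) f Q → (graph M).cl w R (Set.range x ∪ Set.range y) ⊆ Q →
        (S.fml.Realize (Sum.elim x y) ↔ S.fml.Realize (Sum.elim (f ∘ x) (f ∘ y))) := by
  obtain ⟨R, hR⟩ := exists_level_realize hI hG S.fml
  refine ⟨R, fun x y f Q hf hQ => ?_⟩
  have := hR (Sum.elim x y) default f Q hf (by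
    rwa [Set.Sum.elim_range, Set.range_eq_empty (default : Fin 0 → M), Set.union_empty])
  rw [Sum.comp_elim, Subsingleton.elim (f ∘ default) (default : Fin 0 → M)] at this
  exact this

end Incidence

/-! ### Weak elimination of imaginaries -/

open Incidence Imaginaries in
theorem theorem4p24 (m n : ℕ) (hm : 1 ≤ m) (hn : 1 ≤ n) :
    Imaginaries.WeakElimImaginaries.{0, 0, w} (Incidence.T m n) := by
  intro M _ _ hT e
  rcases e with a | ⟨S, q⟩
  · refine ⟨1, fun _ => a, ?_, fun _ => ?_⟩
    · exact Set.Definable.singleton_of_mem _ ⟨0, rfl⟩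
    · exact ⟨_, Set.finite_singleton _, Set.Definable.singleton _ _, rfl⟩
  obtain ⟨a₀, rfl⟩ := Quotient.exists_rep q
  change ∃ (k : ℕ) (a : Fin k → M), Meq.cls S a₀ ∈ dcl _ _ ∧ ∀ i, _ ∈ acl _ {Meq.cls S a₀}
  set e := Meq.cls S a₀ with he
  obtain ⟨hI, hG⟩ := generic_graph (N := M) hm hn
  obtain ⟨R, hR⟩ := exists_level_imagSort hI hG S
  obtain ⟨K, hK⟩ := IncGraph.exists_level hG S.equiv hR
  have hra : ∀ s k, a₀ k ∈ (graph M).cl (weight m n) s (Set.range a₀) := fun s k =>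
    IncGraph.subset_cl s _ ⟨k, rfl⟩
  have hfin : ∀ s, ((graph M).cl (weight m n) s (Set.range a₀)).Finite := fun s =>
    IncGraph.finite_cl hG s (Set.finite_range a₀)
  let C : Set M := {x | Meq.real lang x ∈ acl (langEq lang M) {e}}
  obtain ⟨s, hs⟩ : ∃ s, ∀ f, (graph M).EmbOn (graph M) f ((graph M).cl (weight m n) s (Set.range a₀)) →
      (∀ x ∈ (graph M).cl (weight m n) s (Set.range a₀), x ∈ C → f x = x) →
      S.fml.Realize (Sum.elim a₀ (f ∘ a₀)) := by
    set A := (graph M).cl (weight m n) K (Set.range a₀)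
    have : Finite A := hfin K
    let ρ : A → M := fun i => i
    let t : Fin S.arity → A := fun k => ⟨a₀ k, hra K k⟩
    have hdef : DefPred (langEq lang M) {e} fun y : A → Meq lang M =>
        ∃ u : Fin 1 → Meq lang M, (∃ z : A → M, (∀ i, y i = Meq.real lang (z i)) ∧ IsCopy ρ z ∧
          u 0 = Meq.cls S (z ∘ t)) ∧ u 0 = e :=
      DefPred.ex (p := fun (y : A → Meq lang M) (u : Fin 1 → Meq lang M) =>
        (∃ z : A → M, (∀ i, y i = Meq.real lang (z i)) ∧ IsCopy ρ z ∧
          u 0 = Meq.cls S (z ∘ t)) ∧ u 0 = e)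
        ((defPred_copy_cls ρ S t {e} Sum.inl (Sum.inr 0)).and
          (DefPred.const (Set.mem_singleton e) (Sum.inr 0)))
    -- A copy of `A` with class `e` that keeps the coordinates in `C` and moves all others off `A`:
    -- the hypothesis of `exists_level`.
    obtain ⟨y, ⟨u, ⟨z, hz, hcopy, hu⟩, hue⟩, hy⟩ := exists_avoiding hdef
      (y₀ := fun i => Meq.real lang (ρ i))
      ⟨fun _ => e, ⟨ρ, fun _ => rfl, ⟨fun _ _ => Iff.rfl, fun _ => Iff.rfl, fun _ _ => Iff.rfl⟩, rfl⟩,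
        rfl⟩ (Set.finite_range fun i : A => Meq.real lang (ρ i))
    obtain ⟨f, hf, hfz⟩ := hcopy.exists_embOn hI
    have hfC : ∀ x ∈ A, x ∈ C → f x = x := by
      intro x hx hxC
      have := (hy ⟨x, hx⟩).1 hxC
      rw [hz] at this
      exact (hfz ⟨x, hx⟩).trans (Meq.real_injective this)
    refine hK a₀ C f hf ?_ hfC fun x hx hfx => ?_
    · have hft : f ∘ a₀ = z ∘ t := funext fun k => hfz (t k)
      rw [hft, ← Meq.cls_eq_cls, ← hu, hue]
    · by_cases hxC : x ∈ C
      · rwa [hfC x hx hxC]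
      · refine absurd ⟨⟨f x, hfx⟩, ?_⟩ ((hy ⟨x, hx⟩).2 hxC)
        change Meq.real lang (f x) = _
        rw [hz, ← hfz]
  set A := (graph M).cl (weight m n) s (Set.range a₀)
  have : Finite A := hfin s
  have hCfin : Finite {i : A // (i : M) ∈ C} := inferInstance
  obtain ⟨k, ⟨b⟩⟩ := Finite.exists_equiv_fin {i : A // (i : M) ∈ C}
  refine ⟨k, fun i => ((b.symm i : A) : M), ?_, fun i => (b.symm i).2⟩
  set P := Set.range fun i => Meq.real lang ((b.symm i : A) : M)
  have hP : ∀ c : {i : A // (i : M) ∈ C}, Meq.real lang ((c : A) : M) ∈ P := fun c =>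
    ⟨b c, by simp⟩
  let ρ : A → M := fun i => i
  let t : Fin S.arity → A := fun k => ⟨a₀ k, hra s k⟩
  -- The classes of copies of `A` that fix `A ∩ C`. The identity copy shows that `e` is one of them,
  -- and `hs` that there is no other.
  have hdef : DefPred (langEq lang M) P fun x : Fin 1 → Meq lang M =>
      ∃ y : A → Meq lang M, (∃ z : A → M, (∀ i, y i = Meq.real lang (z i)) ∧ IsCopy ρ z ∧
        x 0 = Meq.cls S (z ∘ t)) ∧
        ∀ c : {i : A // (i : M) ∈ C}, y c = Meq.real lang ((c : A) : M) :=
    DefPred.ex (p := fun (x : Fin 1 → Meq lang M) (y : A → Meq lang M) =>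
      (∃ z : A → M, (∀ i, y i = Meq.real lang (z i)) ∧ IsCopy ρ z ∧ x 0 = Meq.cls S (z ∘ t)) ∧
        ∀ c : {i : A // (i : M) ∈ C}, y c = Meq.real lang ((c : A) : M))
      ((defPred_copy_cls ρ S t P Sum.inr (Sum.inl 0)).and
        (DefPred.all fun c => DefPred.const (hP c) (Sum.inr (c : A))))
  refine hdef.congr fun x => ?_
  constructor
  · rintro hx
    exact ⟨fun i => Meq.real lang (ρ i), ⟨ρ, fun _ => rfl,
      ⟨fun _ _ => Iff.rfl, fun _ => Iff.rfl, fun _ _ => Iff.rfl⟩, hx⟩, fun _ => rfl⟩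
  · rintro ⟨y, ⟨z, hz, hcopy, hx⟩, hc⟩
    obtain ⟨f, hf, hfz⟩ := hcopy.exists_embOn hI
    have hE := hs f hf fun c hcA hcC => by
      have := hc ⟨⟨c, hcA⟩, hcC⟩
      rw [hz] at this
      exact (hfz ⟨c, hcA⟩).trans (Meq.real_injective this)
    have hft : f ∘ a₀ = z ∘ t := funext fun k => hfz (t k)
    rw [hft, ← Meq.cls_eq_cls] at hE
    exact hx.trans hE.symm
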